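/- Let $p$ be a prime, let $k\ge 2$ and $M\ge 1$ be integers, and suppose that $m:=v_p(M)\ge v_p(2p)$. Put $F_M=\mathbb Q_p(\zeta_M)\subset\overline{\mathbb Q}_p$, with $v_p(p)=1$. Let $$\mathcal K_M^{++}=\Big\{\sum_{n\ge 0}a_nq_M^n\in F_M[[q_M]] : v_p(a_n)+\tfrac nM\ge 0\ \text{ for all } n\Big\},\qquad \mathcal K_M^+=\mathcal K_M^{++}\otimes_{\mathbb Z_p}\mathbb Q_p .$$ Let $\mathrm P_m$ be the group of matrices $\begin{pmatrix}1&b\\0&d\end{pmatrix}\in\mathrm{GL}_2(\mathbb Z_p)$ with $b\in p^m\mathbb Z_p$ and $d\in 1+p^m\mathbb Z_p$. It acts on the right on $F_M[[\tilde q_M,t]][e_1,e_2]$ by ring automorphisms, trivially on $F_M$ (and continuously in $\tilde q_M$ and $t$), by $$t\mapsto d\,t,\qquad \tilde q_M\mapsto \tilde q_M\exp(bt/M),\qquad e_1\mapsto e_1+b\,e_2,\qquad e_2\mapsto d\,e_2 .$$ Let $\tilde{\mathcal O}$ be the ring of the series $\sum_n a_n\tilde q_M^n$ with $a_n\in F_M$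 and $v_p(a_n)+\frac nM\ge 0$ for all $n$; let $T(1)=\mathrm{Sym}^{k-2}(\mathbb Z_pe_1\oplus\mathbb Z_pe_2)(1)$, where $\mathbb Z_p(1)$ is identified with $\mathbb Z_p t$; and put $\tilde q=\tilde q_M^M$. Thus $\tilde{\mathcal O}\,\hat\otimes\,T(1)[[t]]$ is the set of the elements $t\sum_{i+j=k-2}\sum_{r,s\ge 0}a_{i,j,r,s}\,\tilde q_M^r\,t^s\,e_1^ie_2^j$ with $a_{i,j,r,s}\in F_M$ and $v_p(a_{i,j,r,s})+\frac rM\ge 0$. For $n_1,n_2\ge 1$ let $$\tilde T_{n_1,n_2}=\big(\tilde{\mathcal O}\,\hat\otimes\,T(1)[[t]]\big)\big/\big(t^{n_1},(\tilde q/p)^{n_2}\big).$$ It is a lattice in the finite-dimensional $\mathbb Q_p$-representation $\tilde T_{n_1,n_2}\otimes\mathbb Q_p$ of $\mathrm P_m$. On this representation let $\partial_{m,1}$ and $\partial_{m,2}$ be the operators $\partial_\gamma(x)=\lim_{n\to\infty}(x*\gamma^{p^n}-x)/p^n$ for $\gamma=\begin{pmatrix}1&p^m\\0&1\end{pmatrix}$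 and $\gamma=\begin{pmatrix}1&0\\0&e^{p^m}\end{pmatrix}$ respectively; they preserve $\tilde T_{n_1,n_2}$, and $\partial_{m,2}$ induces an operator on $\tilde T_{n_1,n_2}/\partial_{m,1}$. Then the map $f(q_M)\mapsto e_1^{k-2}\,t\,f(\tilde q_M)$ induces an isomorphism of $\mathbb Q_p$-vector spaces $$\mathcal K_M^+\ \xrightarrow{\ \sim\ }\ \varprojlim_{n_1}\Big(\big(\varprojlim_{n_2}(\tilde T_{n_1,n_2}/\partial_{m,1})^{\partial_{m,2}=p^m}\big)\otimes_{\mathbb Z_p}\mathbb Q_p\Big).$$ -/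

import Mathlib

open Filter Topology
open scoped TensorProduct

noncomputable section

namespace EllPolylog

/-! ### The coefficient field and the rings of power series -/

section Rings

variable (p : ℕ) [Fact p.Prime] (M : ℕ)

/-- The field `F_M = ℚ_p(ζ_M)` inside the fixed algebraic closure of `ℚ_p`. Its norm is the
restriction of the `p`-adic norm, so that `‖a‖ = p ^ (-v_p(a))` with `v_p(p) = 1`. -/
abbrev CycF : IntermediateField ℚ_[p] (PadicAlgCl p) :=
  IntermediateField.adjoin ℚ_[p] {z : PadicAlgCl p | z ^ M = 1}

variable {p M} in
lemma norm_add_le_max' (x y : CycF p M) : ‖x + y‖ ≤ max ‖x‖ ‖y‖ :=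
  IsUltrametricDist.norm_add_le_max (x : PadicAlgCl p) y

variable {p M} in
lemma norm_smul_le' (a : ℤ_[p]) (x : CycF p M) : ‖a • x‖ ≤ ‖x‖ := by
  have h : ((a • x : CycF p M) : PadicAlgCl p) = (a : ℚ_[p]) • (x : PadicAlgCl p) := rfl
  have h2 : ‖((a • x : CycF p M) : PadicAlgCl p)‖ ≤ ‖(x : PadicAlgCl p)‖ := by
    rw [h, norm_smul]
    exact mul_le_of_le_one_left (norm_nonneg _) a.2
  exact h2

/-- The `ℤ_p`-module underlying `𝒦_M⁺⁺`, the `q/p`-adic completion of the ring of integers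
of `𝔎_M⁺`: the power series `∑ a_n q_M ^ n` over `F_M` with `v_p(a_n) + n / M ≥ 0` for all `n`. -/
def KPlusPlus : Submodule ℤ_[p] (PowerSeries (CycF p M)) where
  carrier := {f | ∀ n : ℕ, ‖PowerSeries.coeff n f‖ ≤ (p : ℝ) ^ ((n : ℝ) / M)}
  zero_mem' n := by
    rw [map_zero, norm_zero]
    positivity
  add_mem' {f g} hf hg n := by
    rw [map_add]
    exact (norm_add_le_max' _ _).trans (max_le (hf n) (hg n))
  smul_mem' a f hf n := (norm_smul_le' a _).trans (hf n)

/-- `𝒦_M⁺ = 𝒦_M⁺⁺ ⊗ ℚ_p`. -/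
abbrev KPlus : Type := ℚ_[p] ⊗[ℤ_[p]] KPlusPlus p M

/-- The ring `F_M[[t]][[q̃_M]]`: the outer variable is `q̃_M`, the inner one is `t`. -/
def QT : Type := PowerSeries (PowerSeries (CycF p M))

instance : CommRing (QT p M) := inferInstanceAs (CommRing (PowerSeries (PowerSeries (CycF p M))))
instance : Algebra ℚ_[p] (QT p M) :=
  inferInstanceAs (Algebra ℚ_[p] (PowerSeries (PowerSeries (CycF p M))))
instance : Algebra ℤ_[p] (QT p M) :=
  inferInstanceAs (Algebra ℤ_[p] (PowerSeries (PowerSeries (CycF p M))))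
instance : IsScalarTower ℤ_[p] ℚ_[p] (QT p M) :=
  inferInstanceAs (IsScalarTower ℤ_[p] ℚ_[p] (PowerSeries (PowerSeries (CycF p M))))

/-- The element `t`. -/
def tt : QT p M := PowerSeries.C (R := PowerSeries (CycF p M)) PowerSeries.X

/-- The element `q̃_M`. -/
def qq : QT p M := PowerSeries.X (R := PowerSeries (CycF p M))

/-- The coefficient in `F_M` of `q̃_M ^ r * t ^ s`. -/
def cf (r s : ℕ) (x : QT p M) : CycF p M :=
  PowerSeries.coeff s (PowerSeries.coeff (R := PowerSeries (CycF p M)) r x)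

lemma cf_zero (r s : ℕ) : cf p M r s 0 = 0 :=
  (congrArg (PowerSeries.coeff s) (map_zero (PowerSeries.coeff (R := PowerSeries (CycF p M)) r))).trans
    (map_zero _)

lemma cf_add (r s : ℕ) (x y : QT p M) : cf p M r s (x + y) = cf p M r s x + cf p M r s y :=
  (congrArg (PowerSeries.coeff s)
    (map_add (PowerSeries.coeff (R := PowerSeries (CycF p M)) r) x y)).trans (map_add _ _ _)

/-- `f(q_M) ↦ f(q̃_M)`. -/
def evalQ (f : PowerSeries (CycF p M)) : QT p M :=
  PowerSeries.map (PowerSeries.C (R := CycF p M)) f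

/-- The symmetric algebra `F_M[[q̃_M, t]][e_1, e_2]`, with `e_1 = X 0` and `e_2 = X 1`. Its
homogeneous part of degree `k - 2` is `F_M[[q̃_M, t]] ⊗ W_k`, where `W_k = Sym^{k-2} V_p`. -/
abbrev SymQT : Type := MvPolynomial (Fin 2) (QT p M)

end Rings

/-! ### The group `P_m` and its action -/

section Group

variable (p : ℕ) [Fact p.Prime] (m : ℕ)

/-- The group `P_m` of matrices `(1, b; 0, d)` in `GL_2(ℤ_p)`, with `b ∈ p ^ m ℤ_p` and
`d ∈ 1 + p ^ m ℤ_p`. -/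
def Pm : Subgroup (GL (Fin 2) ℤ_[p]) where
  carrier := {g | g 0 0 = 1 ∧ g 1 0 = 0 ∧ (p : ℤ_[p]) ^ m ∣ g 0 1 ∧ (p : ℤ_[p]) ^ m ∣ g 1 1 - 1}
  one_mem' := by simp
  mul_mem' {g h} hg hh := by
    obtain ⟨g1, g2, g3, g4⟩ := hg
    obtain ⟨h1, h2, h3, h4⟩ := hh
    simp only [Set.mem_ofPred_eq, Units.val_mul, Matrix.mul_apply, Fin.sum_univ_two, g1, g2, h1, h2]
    refine ⟨by ring, by ring, ?_, ?_⟩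
    · rw [one_mul]; exact dvd_add h3 (Dvd.dvd.mul_right g3 _)
    · have : (0 * h 0 1 + g 1 1 * h 1 1 - 1 : ℤ_[p])
          = (g 1 1 - 1) * h 1 1 + (h 1 1 - 1) := by ring
      rw [this]; exact dvd_add (Dvd.dvd.mul_right g4 _) h4
  inv_mem' {g} hg := by
    obtain ⟨g1, g2, g3, g4⟩ := hg
    have e (i j : Fin 2) : ∑ l, g⁻¹ i l * g l j = (1 : Matrix (Fin 2) (Fin 2) ℤ_[p]) i j := by
      rw [← Matrix.mul_apply]
      simp
    have e00 := e 0 0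
    have e10 := e 1 0
    have e01 := e 0 1
    have e11 := e 1 1
    simp only [Fin.sum_univ_two, g1, g2, Matrix.one_apply_eq, mul_one, mul_zero, add_zero,
      Matrix.one_apply_ne (show (1 : Fin 2) ≠ 0 by decide),
      Matrix.one_apply_ne (show (0 : Fin 2) ≠ 1 by decide)] at e00 e10 e01 e11
    have e11' : g⁻¹ 1 1 * g 1 1 = 1 := by simpa [e10] using e11
    have hb : g⁻¹ 0 1 = - (g 0 1 * g⁻¹ 1 1) := by
      rw [e00] at e01
      linear_combination (g⁻¹ 1 1) * e01 - (g⁻¹ 0 1) * e11'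
    refine ⟨e00, e10, ?_, ?_⟩
    · rw [hb]; exact (Dvd.dvd.mul_right g3 _).neg_right
    · have : g⁻¹ 1 1 - 1 = - (g⁻¹ 1 1 * (g 1 1 - 1)) := by linear_combination e11'
      rw [this]; exact (Dvd.dvd.mul_left g4 _).neg_right

lemma two_mul_padicValNat_factorial_le (hm : padicValNat p (2 * p) ≤ m) (n : ℕ) :
    2 * padicValNat p n.factorial + n ≤ 2 * (m * n) := by
  have hp := (Fact.out : p.Prime)
  have h := sub_one_mul_padicValNat_factorial (p := p) n
  have h1 : (p - 1) * padicValNat p n.factorial ≤ n := by omega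
  rw [padicValNat.mul (by norm_num) hp.ne_zero, padicValNat_self] at hm
  rcases hp.eq_two_or_odd' with rfl | hodd
  · rw [padicValNat_self] at hm
    nlinarith
  · have : 3 ≤ p := by
      rcases hodd with ⟨c, rfl⟩
      have := hp.two_le
      omega
    have h2 : 2 * padicValNat p n.factorial ≤ (p - 1) * padicValNat p n.factorial :=
      Nat.mul_le_mul_right _ (by omega)
    nlinarith [Nat.zero_le (padicValNat p 2)]

lemma padicValNat_factorial_add_le (hm : padicValNat p (2 * p) ≤ m) (n : ℕ) (hn : n ≠ 0) :
    padicValNat p n.factorial + m ≤ m * n := by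
  have hp := (Fact.out : p.Prime)
  have h := sub_one_mul_padicValNat_factorial_lt_of_ne_zero p hn
  rw [padicValNat.mul (by norm_num) hp.ne_zero, padicValNat_self] at hm
  have h1 : padicValNat p n.factorial ≤ (p - 1) * padicValNat p n.factorial :=
    Nat.le_mul_of_pos_left _ (by have := hp.two_le; omega)
  obtain ⟨c, rfl⟩ := Nat.exists_eq_succ_of_ne_zero hn
  have : padicValNat p (c + 1).factorial ≤ c := by
    simp only [Nat.succ_eq_add_one] at *
    omega
  have h2 : c ≤ m * c := Nat.le_mul_of_pos_left _ (by omega)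
  simp only [Nat.succ_eq_add_one, mul_add, mul_one] at *
  omega

lemma norm_exp_term (n : ℕ) : ‖((p : ℚ_[p]) ^ m) ^ n / (n.factorial : ℚ_[p])‖
    = (p : ℝ) ^ ((padicValNat p n.factorial : ℤ) - (m * n : ℕ)) := by
  have hp : (p : ℝ) ≠ 0 := by exact_mod_cast (Fact.out : p.Prime).ne_zero
  have h : ‖(n.factorial : ℚ_[p])‖ = (p : ℝ) ^ (-(padicValNat p n.factorial : ℤ)) := by
    rw [Padic.norm_eq_zpow_neg_valuation (by exact_mod_cast n.factorial_ne_zero),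
      Padic.valuation_natCast]
  rw [norm_div, h, ← pow_mul, norm_pow, Padic.norm_p, zpow_sub₀ hp, zpow_neg, zpow_natCast,
    zpow_natCast, inv_pow]
  field_simp

lemma norm_exp_sub_one_le (hm : padicValNat p (2 * p) ≤ m) :
    ‖NormedSpace.exp ((p : ℚ_[p]) ^ m) - 1‖ ≤ (p : ℝ) ^ (-(m : ℤ)) := by
  have hp : (1 : ℝ) < p := by exact_mod_cast (Fact.out : p.Prime).one_lt
  have hs : Summable fun n : ℕ => ((p : ℚ_[p]) ^ m) ^ n / (n.factorial : ℚ_[p]) := by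
    apply NonarchimedeanAddGroup.summable_of_tendsto_cofinite_zero
    rw [Nat.cofinite_eq_atTop, tendsto_zero_iff_norm_tendsto_zero]
    have h0 : Tendsto (fun n : ℕ => ((p : ℝ) ^ (-(1 / 2) : ℝ)) ^ n) atTop (𝓝 0) :=
      tendsto_pow_atTop_nhds_zero_of_lt_one (by positivity)
        (Real.rpow_lt_one_of_one_lt_of_neg hp (by norm_num))
    refine squeeze_zero (fun _ => norm_nonneg _) (fun n => ?_) h0
    rw [norm_exp_term, ← Real.rpow_intCast, ← Real.rpow_mul_natCast (by positivity)]
    apply Real.rpow_le_rpow_of_exponent_le hp.le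
    have := two_mul_padicValNat_factorial_le p m hm n
    have h' : (2 * padicValNat p n.factorial + n : ℝ) ≤ 2 * (m * n) := by exact_mod_cast this
    rw [Int.cast_sub, Int.cast_natCast, Int.cast_natCast, Nat.cast_mul]
    linarith
  have he : NormedSpace.exp ((p : ℚ_[p]) ^ m) - 1
      = ∑' n : ℕ, ((p : ℚ_[p]) ^ m) ^ (n + 1) / ((n + 1).factorial : ℚ_[p]) := by
    rw [NormedSpace.exp_eq_tsum_div]
    simp only
    rw [hs.tsum_eq_zero_add]
    simp
  rw [he]
  refine (IsUltrametricDist.norm_tsum_le _).trans (ciSup_le fun n => ?_)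
  rw [norm_exp_term]
  apply zpow_le_zpow_right₀ hp.le
  have := padicValNat_factorial_add_le p m hm (n + 1) (by omega)
  omega

/-- The `p`-adic number `e ^ {p ^ m}`, an element of `1 + p ^ m ℤ_p`. -/
def expP (hm : padicValNat p (2 * p) ≤ m) : ℤ_[p] :=
  ⟨NormedSpace.exp ((p : ℚ_[p]) ^ m), by
    have h := norm_exp_sub_one_le p m hm
    have h1 : (p : ℝ) ^ (-(m : ℤ)) ≤ 1 :=
      zpow_le_one_of_nonpos₀ (by exact_mod_cast (Fact.out : p.Prime).one_lt.le) (by simp)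
    have := IsUltrametricDist.norm_add_le_max (NormedSpace.exp ((p : ℚ_[p]) ^ m) - 1) 1
    rw [sub_add_cancel, norm_one] at this
    exact this.trans (max_le (h.trans h1) le_rfl)⟩

lemma dvd_expP_sub_one (hm : padicValNat p (2 * p) ≤ m) :
    (p : ℤ_[p]) ^ m ∣ expP p m hm - 1 := by
  rw [← Ideal.mem_span_singleton, ← PadicInt.norm_le_pow_iff_mem_span_pow]
  exact norm_exp_sub_one_le p m hm

lemma isUnit_expP (hm : padicValNat p (2 * p) ≤ m) : IsUnit (expP p m hm) := by
  have hp := (Fact.out : p.Prime)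
  have hm1 : m ≠ 0 := by
    rw [padicValNat.mul (by norm_num) hp.ne_zero, padicValNat_self] at hm
    omega
  apply IsLocalRing.isUnit_of_mem_nonunits_one_sub_self
  intro hu
  have h1 : (p : ℤ_[p]) ∣ 1 - expP p m hm := by
    rw [dvd_sub_comm]
    exact (dvd_pow_self _ hm1).trans (dvd_expP_sub_one p m hm)
  exact PadicInt.prime_p.not_isUnit (isUnit_of_dvd_unit h1 hu)

/-- The element `(p ^ m, 0)`, that is the matrix `(1, p ^ m; 0, 1)`, of `P_m`. -/
def uElt : Pm p m :=
  ⟨Matrix.GeneralLinearGroup.mk'' !![1, (p : ℤ_[p]) ^ m; 0, 1] (by simp),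
    rfl, rfl, dvd_refl _, (dvd_zero _).trans (dvd_of_eq (sub_self (1 : ℤ_[p])).symm)⟩

/-- The element `(0, p ^ m)`, that is the matrix `(1, 0; 0, e ^ {p ^ m})`, of `P_m`. -/
def gammaElt (hm : padicValNat p (2 * p) ≤ m) : Pm p m :=
  ⟨Matrix.GeneralLinearGroup.mk'' !![1, 0; 0, expP p m hm] (by simpa using isUnit_expP p m hm),
    rfl, rfl, dvd_zero _, dvd_expP_sub_one p m hm⟩

end Group

section Action

variable {p : ℕ} [Fact p.Prime] (M : ℕ) {m : ℕ}

/-- The action of `g = (1, b; 0, d)` on `F_M[[q̃_M, t]]`: it is trivial on `F_M` and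
`t * g = d t`, `q̃_M * g = q̃_M exp(b t / M)`. -/
def actQT (g : Pm p m) : QT p M →+* QT p M :=
  let b : CycF p M := algebraMap ℤ_[p] (CycF p M) (g.1 0 1)
  let d : CycF p M := algebraMap ℤ_[p] (CycF p M) (g.1 1 1)
  (PowerSeries.rescale (R := PowerSeries (CycF p M))
    (PowerSeries.rescale (b / (M : CycF p M)) (PowerSeries.exp (CycF p M)))).comp
    (PowerSeries.map (PowerSeries.rescale d))

/-- The action of `g = (1, b; 0, d)` on `F_M[[q̃_M, t]][e_1, e_2]`, which extends the previous one
by `e_1 * g = e_1 + b e_2` and `e_2 * g = d e_2`. -/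
def act (g : Pm p m) : SymQT p M →+* SymQT p M :=
  MvPolynomial.eval₂Hom (MvPolynomial.C.comp (actQT M g))
    ![(MvPolynomial.X 0 : SymQT p M)
        + MvPolynomial.C (algebraMap ℤ_[p] (QT p M) (g.1 0 1)) * MvPolynomial.X 1,
      MvPolynomial.C (algebraMap ℤ_[p] (QT p M) (g.1 1 1)) * MvPolynomial.X 1]

lemma algebraMap_QT {R : Type*} [CommRing R] [Algebra R (CycF p M)] (c : R) :
    algebraMap R (PowerSeries (PowerSeries (CycF p M))) c
      = PowerSeries.C (PowerSeries.C (algebraMap R (CycF p M) c)) :=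
  PowerSeries.algebraMap_apply.trans (congrArg _ PowerSeries.algebraMap_apply)

lemma rescale_C' {R : Type*} [CommRing R] (a c : R) :
    PowerSeries.rescale a (PowerSeries.C c) = PowerSeries.C c := by
  ext n
  rw [PowerSeries.coeff_rescale, PowerSeries.coeff_C]
  split_ifs with h <;> simp [h]

lemma actQT_algebraMap (g : Pm p m) (c : ℚ_[p]) :
    actQT M g (algebraMap ℚ_[p] (QT p M) c) = algebraMap ℚ_[p] (QT p M) c := by
  change PowerSeries.rescale _ (PowerSeries.map _
    (algebraMap ℚ_[p] (PowerSeries (PowerSeries (CycF p M))) c)) =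
    algebraMap ℚ_[p] (PowerSeries (PowerSeries (CycF p M))) c
  rw [algebraMap_QT, PowerSeries.map_C, rescale_C', rescale_C']

lemma actQT_tt (g : Pm p m) :
    actQT M g (tt p M) = algebraMap ℤ_[p] (QT p M) (g.1 1 1) * tt p M := by
  change PowerSeries.rescale _ (PowerSeries.map _ (PowerSeries.C PowerSeries.X)) =
    algebraMap ℤ_[p] (PowerSeries (PowerSeries (CycF p M))) _ * PowerSeries.C PowerSeries.X
  rw [algebraMap_QT, PowerSeries.map_C, rescale_C', PowerSeries.rescale_X, map_mul]
  rfl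

lemma actQT_qq (g : Pm p m) : ∃ u : QT p M, actQT M g (qq p M) = u * qq p M :=
  ⟨PowerSeries.C (R := PowerSeries (CycF p M)) (PowerSeries.rescale
    (algebraMap ℤ_[p] (CycF p M) (g.1 0 1) / (M : CycF p M)) (PowerSeries.exp (CycF p M))), by
    change PowerSeries.rescale _ (PowerSeries.map _ PowerSeries.X) =
      PowerSeries.C _ * (PowerSeries.X : PowerSeries (PowerSeries (CycF p M)))
    rw [PowerSeries.map_X, PowerSeries.rescale_X]
    rfl⟩

/-- The action of an element of `P_m`, as a `ℚ_p`-linear map. -/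
def actLin (g : Pm p m) : SymQT p M →ₗ[ℚ_[p]] SymQT p M where
  toFun := act M g
  map_add' := map_add _
  map_smul' c x := by
    have h : algebraMap ℚ_[p] (SymQT p M) c
      = MvPolynomial.C (algebraMap ℚ_[p] (QT p M) c) := rfl
    rw [Algebra.smul_def, map_mul, RingHom.id_apply, Algebra.smul_def, h]
    simp [act, actQT_algebraMap]

end Action

section Modules

variable (p : ℕ) [Fact p.Prime] (M k : ℕ)

/-- `F_M[[q̃_M, t]] ⊗ W_k`, with `W_k = Sym^{k-2}(ℚ_p e_1 ⊕ ℚ_p e_2)`: the homogeneous elements of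
degree `k - 2`. -/
def W : Submodule ℚ_[p] (SymQT p M) :=
  (MvPolynomial.homogeneousSubmodule (Fin 2) (QT p M) (k - 2)).restrictScalars ℚ_[p]

/-- The lattice of the elements of `F_M[[q̃_M, t]] ⊗ W_k` whose coefficients
`∑ a_{r,s} q̃_M ^ r t ^ s` satisfy `v_p(a_{r,s}) + r / M ≥ 0` for all `r` and `s`. -/
def N : Submodule ℤ_[p] (SymQT p M) where
  carrier := {x | x ∈ W p M k ∧ ∀ (μ : Fin 2 →₀ ℕ) (r s : ℕ),
    ‖cf p M r s (x.coeff μ)‖ ≤ (p : ℝ) ^ ((r : ℝ) / M)}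
  zero_mem' := ⟨zero_mem _, fun μ r s => by
    rw [MvPolynomial.coeff_zero, cf_zero, norm_zero]
    positivity⟩
  add_mem' {x y} hx hy := ⟨add_mem hx.1 hy.1, fun μ r s => by
    rw [MvPolynomial.coeff_add, cf_add]
    exact (norm_add_le_max' _ _).trans (max_le (hx.2 μ r s) (hy.2 μ r s))⟩
  smul_mem' a x hx := ⟨by
      rw [← algebraMap_smul ℚ_[p] a x]
      exact (W p M k).smul_mem _ hx.1,
    fun μ r s => (norm_smul_le' a (cf p M r s (x.coeff μ))).trans (hx.2 μ r s)⟩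

/-- Multiplication by an element of `F_M[[q̃_M, t]]`. -/
abbrev mulBy (a : QT p M) : SymQT p M →ₗ[ℚ_[p]] SymQT p M :=
  LinearMap.mulLeft ℚ_[p] (MvPolynomial.C a)

/-- `F_M[[q̃_M, t]] ⊗ W_k(1)`. The twist is realised by the identification of `ℤ_p(1)` with `ℤ_p t`,
so that this is `t · (F_M[[q̃_M, t]] ⊗ W_k)`. -/
def W1 : Submodule ℚ_[p] (SymQT p M) := (W p M k).map (mulBy p M (tt p M))

/-- The lattice `ι(𝔎_M⁺⁺)^ ⊗ T(1)[[t]]` of `F_M[[q̃_M, t]] ⊗ W_k(1)`, where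
`T(1) = Sym^{k-2}(ℤ_p e_1 ⊕ ℤ_p e_2)(1)`. -/
def N1 : Submodule ℤ_[p] (SymQT p M) :=
  (N p M k).map ((mulBy p M (tt p M)).restrictScalars ℤ_[p])

variable (n₁ n₂ : ℕ)

/-- `t ^ {n₁} W1 + q̃ ^ {n₂} W1`, where `q̃ = q̃_M ^ M`. -/
def J : Submodule ℚ_[p] (SymQT p M) :=
  (W1 p M k).map (mulBy p M (tt p M ^ n₁)) ⊔ (W1 p M k).map (mulBy p M ((qq p M ^ M) ^ n₂))

/-- The finite dimensional `ℚ_p`-vector space `W1 / (t ^ {n₁}, q̃ ^ {n₂})`, that is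
`T̃_{n₁,n₂} ⊗ ℚ_p`. -/
def V : Type := W1 p M k ⧸ (J p M k n₁ n₂).submoduleOf (W1 p M k)

instance : AddCommGroup (V p M k n₁ n₂) :=
  inferInstanceAs (AddCommGroup (W1 p M k ⧸ (J p M k n₁ n₂).submoduleOf (W1 p M k)))
instance : Module ℚ_[p] (V p M k n₁ n₂) :=
  inferInstanceAs (Module ℚ_[p] (W1 p M k ⧸ (J p M k n₁ n₂).submoduleOf (W1 p M k)))
instance : Module ℤ_[p] (V p M k n₁ n₂) :=
  inferInstanceAs (Module ℤ_[p] (W1 p M k ⧸ (J p M k n₁ n₂).submoduleOf (W1 p M k)))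
instance : IsScalarTower ℤ_[p] ℚ_[p] (V p M k n₁ n₂) :=
  inferInstanceAs (IsScalarTower ℤ_[p] ℚ_[p] (W1 p M k ⧸ (J p M k n₁ n₂).submoduleOf (W1 p M k)))

/-- The projection `W1 → V`. -/
def toV : W1 p M k →ₗ[ℚ_[p]] V p M k n₁ n₂ := ((J p M k n₁ n₂).submoduleOf (W1 p M k)).mkQ

/-- `T̃_{n₁,n₂}`: the image of `N1` in `V`. It is `N1 / (t ^ {n₁} N1 + (q̃ / p) ^ {n₂} N1)`. -/
def T : Submodule ℤ_[p] (V p M k n₁ n₂) :=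
  ((N1 p M k).comap ((W1 p M k).subtype.restrictScalars ℤ_[p])).map
    ((toV p M k n₁ n₂).restrictScalars ℤ_[p])

variable {p k} {m : ℕ}

lemma act_mem_W (g : Pm p m) {x : SymQT p M} (hx : x ∈ W p M k) : actLin M g x ∈ W p M k := by
  have hx' : MvPolynomial.IsHomogeneous x (k - 2) := hx
  have := hx'.eval₂ (MvPolynomial.C.comp (actQT M g))
    ![(MvPolynomial.X 0 : SymQT p M)
        + MvPolynomial.C (algebraMap ℤ_[p] (QT p M) (g.1 0 1)) * MvPolynomial.X 1,
      MvPolynomial.C (algebraMap ℤ_[p] (QT p M) (g.1 1 1)) * MvPolynomial.X 1]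
    (n := 1) (fun r => MvPolynomial.isHomogeneous_C _ _) (fun i => by
      have h (a : QT p M) : MvPolynomial.IsHomogeneous
          (MvPolynomial.C a * MvPolynomial.X (1 : Fin 2)) 1 := by
        simpa using (MvPolynomial.isHomogeneous_C _ a).mul (MvPolynomial.isHomogeneous_X _ 1)
      fin_cases i
      · exact (MvPolynomial.isHomogeneous_X _ 0).add (h _)
      · exact h _)
  rw [one_mul] at this
  exact this

lemma act_mulBy (g : Pm p m) (a : QT p M) (x : SymQT p M) :
    actLin M g (mulBy p M a x) = mulBy p M (actQT M g a) (actLin M g x) := by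
  simp [actLin, act]

lemma mulBy_mem_W (a : QT p M) {x : SymQT p M} (hx : x ∈ W p M k) : mulBy p M a x ∈ W p M k := by
  have := (MvPolynomial.homogeneousSubmodule (Fin 2) (QT p M) (k - 2)).smul_mem a hx
  rwa [MvPolynomial.smul_eq_C_mul] at this

lemma mulBy_mulBy (a b : QT p M) (x : SymQT p M) :
    mulBy p M a (mulBy p M b x) = mulBy p M (a * b) x := by
  simp [mul_assoc]

lemma mulBy_mem_W1 (a : QT p M) {x : SymQT p M} (hx : x ∈ W1 p M k) :
    mulBy p M a x ∈ W1 p M k := by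
  obtain ⟨y, hy, rfl⟩ := hx
  exact ⟨mulBy p M a y, mulBy_mem_W M a hy, by rw [mulBy_mulBy, mulBy_mulBy, mul_comm]⟩

lemma act_mem_W1 (g : Pm p m) {x : SymQT p M} (hx : x ∈ W1 p M k) :
    actLin M g x ∈ W1 p M k := by
  obtain ⟨y, hy, rfl⟩ := hx
  rw [act_mulBy, actQT_tt, mul_comm, ← mulBy_mulBy]
  exact ⟨_, mulBy_mem_W M _ (act_mem_W M g hy), rfl⟩

lemma act_mem_J (g : Pm p m) {x : SymQT p M} (hx : x ∈ J p M k n₁ n₂) :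
    actLin M g x ∈ J p M k n₁ n₂ := by
  obtain ⟨_, ⟨y, hy, rfl⟩, _, ⟨z, hz, rfl⟩, rfl⟩ := Submodule.mem_sup.1 hx
  obtain ⟨u, hu⟩ := actQT_qq M g
  rw [map_add, act_mulBy, act_mulBy]
  simp only [map_pow, actQT_tt, hu, mul_pow]
  rw [mul_comm, mul_comm _ ((qq p M ^ M) ^ n₂), ← mulBy_mulBy, ← mulBy_mulBy]
  exact Submodule.add_mem_sup ⟨_, mulBy_mem_W1 M _ (act_mem_W1 M g hy), rfl⟩
    ⟨_, mulBy_mem_W1 M _ (act_mem_W1 M g hz), rfl⟩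

lemma J_anti {n₁ n₁' n₂ n₂' : ℕ} (h₁ : n₁ ≤ n₁') (h₂ : n₂ ≤ n₂') :
    J p M k n₁' n₂' ≤ J p M k n₁ n₂ := by
  refine sup_le_sup ?_ ?_
  · rintro _ ⟨x, hx, rfl⟩
    rw [← Nat.add_sub_of_le h₁, pow_add, ← mulBy_mulBy]
    exact ⟨_, mulBy_mem_W1 M _ hx, rfl⟩
  · rintro _ ⟨x, hx, rfl⟩
    rw [← Nat.add_sub_of_le h₂, pow_add, ← mulBy_mulBy]
    exact ⟨_, mulBy_mem_W1 M _ hx, rfl⟩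

/-- The action of `P_m` on `F_M[[q̃_M, t]] ⊗ W_k(1)`. -/
def actW1 (g : Pm p m) : W1 p M k →ₗ[ℚ_[p]] W1 p M k :=
  (actLin M g).restrict fun _ hx => act_mem_W1 M g hx

/-- The action of `P_m` on `V`. -/
def rho (g : Pm p m) : V p M k n₁ n₂ →ₗ[ℚ_[p]] V p M k n₁ n₂ :=
  Submodule.mapQ ((J p M k n₁ n₂).submoduleOf (W1 p M k)) ((J p M k n₁ n₂).submoduleOf (W1 p M k))
    (actW1 M g) fun _ hx => act_mem_J M n₁ n₂ g hx

/-- `IsPartial M n₁ n₂ g x y` says that `y = ∂_g(x)`, i.e. that `(x * g ^ {p ^ n} - x) / p ^ n` tends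
to `y`, for the canonical topology of the finite dimensional `ℚ_p`-vector space `V`. -/
def IsPartial (g : Pm p m) (x y : V p M k n₁ n₂) : Prop :=
  Tendsto (fun n : ℕ => ((p : ℚ_[p]) ^ n)⁻¹ • (rho M n₁ n₂ (g ^ p ^ n) x - x)) atTop
    (@nhds _ (moduleTopology ℚ_[p] (V p M k n₁ n₂)) y)

variable {M n₁ n₂}

lemma IsPartial.zero (g : Pm p m) : IsPartial (k := k) M n₁ n₂ g 0 0 := by
  simp only [IsPartial, map_zero, sub_zero, smul_zero]
  exact @tendsto_const_nhds _ (moduleTopology ℚ_[p] (V p M k n₁ n₂)) _ _ _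

lemma IsPartial.add {g : Pm p m} {x y x' y' : V p M k n₁ n₂} (h : IsPartial M n₁ n₂ g x y)
    (h' : IsPartial M n₁ n₂ g x' y') : IsPartial M n₁ n₂ g (x + x') (y + y') := by
  let _ := moduleTopology ℚ_[p] (V p M k n₁ n₂)
  have := ModuleTopology.continuousAdd ℚ_[p] (V p M k n₁ n₂)
  refine (Tendsto.add h h').congr fun n => ?_
  rw [← smul_add, map_add]
  congr 1
  abel

lemma IsPartial.smul {g : Pm p m} {x y : V p M k n₁ n₂} (a : ℤ_[p])
    (h : IsPartial M n₁ n₂ g x y) : IsPartial M n₁ n₂ g (a • x) (a • y) := by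
  let _ := moduleTopology ℚ_[p] (V p M k n₁ n₂)
  have := ModuleTopology.continuousSMul ℚ_[p] (V p M k n₁ n₂)
  rw [← algebraMap_smul ℚ_[p] a x, ← algebraMap_smul ℚ_[p] a y]
  refine (Tendsto.const_smul h (algebraMap ℤ_[p] ℚ_[p] a)).congr fun n => ?_
  rw [map_smul, ← smul_sub, smul_comm]

/-- The projection `V_{n₁',n₂'} → V_{n₁,n₂}`. -/
def tr {n₁ n₁' n₂ n₂' : ℕ} (h₁ : n₁ ≤ n₁') (h₂ : n₂ ≤ n₂') :
    V p M k n₁' n₂' →ₗ[ℚ_[p]] V p M k n₁ n₂ :=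
  Submodule.factor (p := (J p M k n₁' n₂').submoduleOf (W1 p M k))
    (p' := (J p M k n₁ n₂).submoduleOf (W1 p M k)) (Submodule.comap_mono (J_anti M h₁ h₂))

lemma toV_surjective : Function.Surjective (toV p M k n₁ n₂) := Submodule.mkQ_surjective _

lemma rho_toV (g : Pm p m) (x : W1 p M k) :
    rho M n₁ n₂ g (toV p M k n₁ n₂ x) = toV p M k n₁ n₂ (actW1 M g x) :=
  Submodule.mapQ_apply _ _ _ _

lemma tr_toV {n₁' n₂' : ℕ} (h₁ : n₁ ≤ n₁') (h₂ : n₂ ≤ n₂') (x : W1 p M k) :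
    tr h₁ h₂ (toV p M k n₁' n₂' x) = toV p M k n₁ n₂ x :=
  Submodule.factor_mk (Submodule.comap_mono (J_anti M h₁ h₂)) x

lemma tr_rho {n₁' n₂' : ℕ} (h₁ : n₁ ≤ n₁') (h₂ : n₂ ≤ n₂') (g : Pm p m) (x : V p M k n₁' n₂') :
    tr h₁ h₂ (rho M n₁' n₂' g x) = rho M n₁ n₂ g (tr h₁ h₂ x) := by
  obtain ⟨x, rfl⟩ := toV_surjective x
  rw [rho_toV, tr_toV, tr_toV, rho_toV]

lemma tr_tr {n₁' n₁'' n₂' n₂'' : ℕ} (h₁ : n₁ ≤ n₁') (h₂ : n₂ ≤ n₂') (h₁' : n₁' ≤ n₁'')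
    (h₂' : n₂' ≤ n₂'') (x : V p M k n₁'' n₂'') :
    tr h₁ h₂ (tr h₁' h₂' x) = tr (h₁.trans h₁') (h₂.trans h₂') x := by
  obtain ⟨x, rfl⟩ := toV_surjective x
  rw [tr_toV, tr_toV, tr_toV]

lemma IsPartial.tr {n₁' n₂' : ℕ} (h₁ : n₁ ≤ n₁') (h₂ : n₂ ≤ n₂') {g : Pm p m}
    {x y : V p M k n₁' n₂'} (h : IsPartial M n₁' n₂' g x y) :
    IsPartial M n₁ n₂ g (tr h₁ h₂ x) (tr h₁ h₂ y) := by
  let _ := moduleTopology ℚ_[p] (V p M k n₁ n₂)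
  let _ := moduleTopology ℚ_[p] (V p M k n₁' n₂')
  have : IsModuleTopology ℚ_[p] (V p M k n₁' n₂') := ⟨rfl⟩
  have := ModuleTopology.continuousSMul ℚ_[p] (V p M k n₁ n₂)
  have := ModuleTopology.continuousAdd ℚ_[p] (V p M k n₁ n₂)
  have hc : Continuous (EllPolylog.tr (M := M) (k := k) (p := p) h₁ h₂) :=
    IsModuleTopology.continuous_of_linearMap _
  refine ((hc.tendsto y).comp h).congr fun n => ?_
  rw [Function.comp_apply, map_smul, map_sub, tr_rho]

lemma tr_mem_T {n₁' n₂' : ℕ} (h₁ : n₁ ≤ n₁') (h₂ : n₂ ≤ n₂') {x : V p M k n₁' n₂'}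
    (hx : x ∈ T p M k n₁' n₂') : tr h₁ h₂ x ∈ T p M k n₁ n₂ := by
  obtain ⟨y, hy, rfl⟩ := hx
  exact ⟨y, hy, (tr_toV h₁ h₂ y).symm⟩

variable (M k n₁ n₂ m)

/-- `∂_{m,1} T̃_{n₁,n₂}`. -/
def dT : Submodule ℤ_[p] (V p M k n₁ n₂) where
  carrier := {y | ∃ x ∈ T p M k n₁ n₂, IsPartial M n₁ n₂ (uElt p m) x y}
  zero_mem' := ⟨0, zero_mem _, .zero _⟩
  add_mem' := fun ⟨x, hx, h⟩ ⟨x', hx', h'⟩ => ⟨x + x', add_mem hx hx', h.add h'⟩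
  smul_mem' a _ := fun ⟨x, hx, h⟩ => ⟨a • x, (T p M k n₁ n₂).smul_mem a hx, h.smul a⟩

/-- `T̃_{n₁,n₂} / ∂_{m,1}`. -/
def Coinv : Type := T p M k n₁ n₂ ⧸ (dT M k n₁ n₂ m).submoduleOf (T p M k n₁ n₂)

instance : AddCommGroup (Coinv (p := p) M k n₁ n₂ m) :=
  inferInstanceAs (AddCommGroup (T p M k n₁ n₂ ⧸ (dT M k n₁ n₂ m).submoduleOf (T p M k n₁ n₂)))
instance : Module ℤ_[p] (Coinv (p := p) M k n₁ n₂ m) :=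
  inferInstanceAs (Module ℤ_[p] (T p M k n₁ n₂ ⧸ (dT M k n₁ n₂ m).submoduleOf (T p M k n₁ n₂)))

variable {M k n₁ n₂ m}

/-- The projection `T̃_{n₁,n₂} → T̃_{n₁,n₂} / ∂_{m,1}`. -/
def cls : T p M k n₁ n₂ →ₗ[ℤ_[p]] Coinv (p := p) M k n₁ n₂ m :=
  ((dT M k n₁ n₂ m).submoduleOf (T p M k n₁ n₂)).mkQ

variable (M k n₁ n₂)

/-- `(T̃_{n₁,n₂} / ∂_{m,1})^{∂_{m,2} = p ^ m}`: the classes of the `x ∈ T̃_{n₁,n₂}` such that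
`∂_{m,2}(x)` and `p ^ m x` have the same class. -/
def Eig (hm : padicValNat p (2 * p) ≤ m) : Submodule ℤ_[p] (Coinv (p := p) M k n₁ n₂ m) where
  carrier := {z | ∃ x y : T p M k n₁ n₂, IsPartial M n₁ n₂ (gammaElt p m hm) x.1 y.1 ∧
    z = cls x ∧ cls y = (p : ℤ_[p]) ^ m • z}
  zero_mem' := ⟨0, 0, .zero _, (map_zero _).symm, by rw [smul_zero, map_zero]⟩
  add_mem' := by
    rintro _ _ ⟨x, y, h, rfl, e⟩ ⟨x', y', h', rfl, e'⟩
    exact ⟨x + x', y + y', h.add h', (map_add _ _ _).symm, by rw [smul_add, ← e, ← e', map_add]⟩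
  smul_mem' := by
    rintro a _ ⟨x, y, h, rfl, e⟩
    exact ⟨a • x, a • y, h.smul a, (map_smul _ _ _).symm, by rw [smul_comm, ← e, map_smul]⟩

/-- The `ℤ_p`-module `(T̃_{n₁,n₂} / ∂_{m,1})^{∂_{m,2} = p ^ m}`. -/
def EigT (hm : padicValNat p (2 * p) ≤ m) : Type := Eig (p := p) M k n₁ n₂ hm

instance (hm : padicValNat p (2 * p) ≤ m) : AddCommGroup (EigT M k n₁ n₂ hm) :=
  inferInstanceAs (AddCommGroup (Eig (p := p) M k n₁ n₂ hm))
instance (hm : padicValNat p (2 * p) ≤ m) : Module ℤ_[p] (EigT M k n₁ n₂ hm) :=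
  inferInstanceAs (Module ℤ_[p] (Eig (p := p) M k n₁ n₂ hm))

variable {M k n₁ n₂}

/-- The projection `T̃_{n₁',n₂'} → T̃_{n₁,n₂}`. -/
def trT {n₁' n₂' : ℕ} (h₁ : n₁ ≤ n₁') (h₂ : n₂ ≤ n₂') :
    T p M k n₁' n₂' →ₗ[ℤ_[p]] T p M k n₁ n₂ :=
  ((tr h₁ h₂).restrictScalars ℤ_[p]).restrict fun _ hx => tr_mem_T h₁ h₂ hx

/-- The projection `T̃_{n₁',n₂'} / ∂_{m,1} → T̃_{n₁,n₂} / ∂_{m,1}`. -/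
def trCoinv {n₁' n₂' : ℕ} (h₁ : n₁ ≤ n₁') (h₂ : n₂ ≤ n₂') :
    Coinv (p := p) M k n₁' n₂' m →ₗ[ℤ_[p]] Coinv (p := p) M k n₁ n₂ m :=
  Submodule.mapQ ((dT M k n₁' n₂' m).submoduleOf (T p M k n₁' n₂'))
    ((dT M k n₁ n₂ m).submoduleOf (T p M k n₁ n₂)) (trT h₁ h₂)
    fun _ ⟨x, hx, h⟩ => ⟨tr h₁ h₂ x, tr_mem_T h₁ h₂ hx, h.tr h₁ h₂⟩

lemma trT_trT {n₁' n₁'' n₂' n₂'' : ℕ} (h₁ : n₁ ≤ n₁') (h₂ : n₂ ≤ n₂') (h₁' : n₁' ≤ n₁'')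
    (h₂' : n₂' ≤ n₂'') (x : T p M k n₁'' n₂'') :
    trT h₁ h₂ (trT h₁' h₂' x) = trT (h₁.trans h₁') (h₂.trans h₂') x :=
  Subtype.ext (tr_tr h₁ h₂ h₁' h₂' x.1)

lemma trCoinv_cls {n₁' n₂' : ℕ} (h₁ : n₁ ≤ n₁') (h₂ : n₂ ≤ n₂') (x : T p M k n₁' n₂') :
    trCoinv (m := m) h₁ h₂ (cls x) = cls (trT h₁ h₂ x) :=
  Submodule.mapQ_apply _ _ _ _

lemma trCoinv_mem {n₁' n₂' : ℕ} (h₁ : n₁ ≤ n₁') (h₂ : n₂ ≤ n₂') (hm : padicValNat p (2 * p) ≤ m)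
    {z : Coinv (p := p) M k n₁' n₂' m} (hz : z ∈ Eig M k n₁' n₂' hm) :
    trCoinv h₁ h₂ z ∈ Eig M k n₁ n₂ hm := by
  obtain ⟨x, y, h, rfl, e⟩ := hz
  refine ⟨trT h₁ h₂ x, trT h₁ h₂ y, h.tr h₁ h₂, trCoinv_cls h₁ h₂ x, ?_⟩
  rw [← map_smul, ← e, trCoinv_cls]

/-- The projection from level `(n₁', n₂')` to level `(n₁, n₂)` of the inverse system
`(T̃_{n₁,n₂} / ∂_{m,1})^{∂_{m,2} = p ^ m}`. -/
def trEig {n₁' n₂' : ℕ} (h₁ : n₁ ≤ n₁') (h₂ : n₂ ≤ n₂') (hm : padicValNat p (2 * p) ≤ m) :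
    EigT M k n₁' n₂' hm →ₗ[ℤ_[p]] EigT M k n₁ n₂ hm :=
  (trCoinv h₁ h₂).restrict (p := Eig M k n₁' n₂' hm) (q := Eig M k n₁ n₂ hm)
    fun _ hz => trCoinv_mem h₁ h₂ hm hz

lemma cls_surjective : Function.Surjective (cls (p := p) (M := M) (k := k) (n₁ := n₁) (n₂ := n₂)
    (m := m)) := Submodule.mkQ_surjective _

lemma trCoinv_comm {n₁' n₂' : ℕ} (h₁ : n₁ ≤ n₁') (h₂ : n₂ ≤ n₂')
    (z : Coinv (p := p) M k n₁' n₂' m) :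
    trCoinv h₁ le_rfl (trCoinv (le_refl n₁') h₂ z)
      = trCoinv le_rfl h₂ (trCoinv h₁ (le_refl n₂') z) := by
  obtain ⟨x, rfl⟩ := cls_surjective z
  rw [trCoinv_cls, trCoinv_cls, trCoinv_cls, trCoinv_cls, trT_trT, trT_trT]

lemma trEig_comm {n₁' n₂' : ℕ} (h₁ : n₁ ≤ n₁') (h₂ : n₂ ≤ n₂') (hm : padicValNat p (2 * p) ≤ m)
    (z : EigT M k n₁' n₂' hm) :
    trEig h₁ le_rfl hm (trEig le_rfl h₂ hm z) = trEig le_rfl h₂ hm (trEig h₁ le_rfl hm z) :=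
  Subtype.ext (trCoinv_comm h₁ h₂ z.1)

variable (M k n₁)

/-- The inverse limit over `n₂` of `(T̃_{n₁,n₂} / ∂_{m,1})^{∂_{m,2} = p ^ m}`. The index `n₂ = 0`,
for which the module is zero, does no harm. -/
def Lim₂ (hm : padicValNat p (2 * p) ≤ m) : Submodule ℤ_[p] (∀ n₂ : ℕ, EigT M k n₁ n₂ hm) where
  carrier := {z | ∀ n₂, trEig le_rfl n₂.le_succ hm (z (n₂ + 1)) = z n₂}
  zero_mem' _ := map_zero _
  add_mem' h h' n₂ := by rw [Pi.add_apply, map_add, h, h']; rfl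
  smul_mem' a _ h n₂ := by rw [Pi.smul_apply, map_smul, h]; rfl

/-- The projection from `Lim₂` at `n₁ + 1` to `Lim₂` at `n₁`. -/
def trLim₂ (hm : padicValNat p (2 * p) ≤ m) : Lim₂ M k (n₁ + 1) hm →ₗ[ℤ_[p]] Lim₂ M k n₁ hm :=
  (LinearMap.pi fun n₂ => (trEig n₁.le_succ le_rfl hm).comp (LinearMap.proj n₂)).restrict
    fun z hz n₂ => (trEig_comm n₁.le_succ n₂.le_succ hm (z (n₂ + 1))).symm.trans
      (congrArg (trEig n₁.le_succ le_rfl hm) (hz n₂))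

/-- The inverse limit over `n₁` of `(lim_{n₂} (T̃_{n₁,n₂} / ∂_{m,1})^{∂_{m,2} = p ^ m}) ⊗ ℚ_p`.
The index `n₁ = 0`, for which the module is zero, does no harm. -/
def Lim (hm : padicValNat p (2 * p) ≤ m) :
    Submodule ℚ_[p] (∀ n₁ : ℕ, ℚ_[p] ⊗[ℤ_[p]] Lim₂ M k n₁ hm) where
  carrier := {z | ∀ n₁, (trLim₂ M k n₁ hm).baseChange ℚ_[p] (z (n₁ + 1)) = z n₁}
  zero_mem' _ := map_zero _
  add_mem' h h' n₁ := by rw [Pi.add_apply, map_add, h, h']; rfl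
  smul_mem' a _ h n₁ := by rw [Pi.smul_apply, map_smul, h]; rfl

variable (p)

/-- The element `e_1 ^ {k-2} t f(q̃_M)` of `F_M[[q̃_M, t]] ⊗ W_k(1)`. -/
def elt (f : PowerSeries (CycF p M)) : W1 p M k :=
  ⟨mulBy p M (tt p M) (mulBy p M (evalQ p M f) (MvPolynomial.X 0 ^ (k - 2))),
    mulBy p M (evalQ p M f) (MvPolynomial.X 0 ^ (k - 2)),
    mulBy_mem_W M _ (MvPolynomial.isHomogeneous_X_pow 0 (k - 2)), rfl⟩

lemma norm_cf_evalQ_le (f : KPlusPlus p M) (r s : ℕ) :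
    ‖cf p M r s (evalQ p M f.1)‖ ≤ (p : ℝ) ^ ((r : ℝ) / M) := by
  have h : cf p M r s (evalQ p M f.1)
      = PowerSeries.coeff s (PowerSeries.C (PowerSeries.coeff r f.1)) :=
    congrArg (PowerSeries.coeff s) (PowerSeries.coeff_map _ _ _)
  rw [h, PowerSeries.coeff_C]
  split_ifs
  · exact f.2 r
  · rw [norm_zero]
    positivity

lemma elt_mem_N1 (f : KPlusPlus p M) : (elt p M k f.1).1 ∈ N1 p M k := by
  refine ⟨mulBy p M (evalQ p M f.1) (MvPolynomial.X 0 ^ (k - 2)),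
    ⟨mulBy_mem_W M _ (MvPolynomial.isHomogeneous_X_pow 0 (k - 2)), fun μ r s => ?_⟩, rfl⟩
  rw [LinearMap.mulLeft_apply, MvPolynomial.coeff_C_mul, MvPolynomial.coeff_X_pow]
  split_ifs
  · rw [mul_one]
    exact norm_cf_evalQ_le p M f r s
  · rw [mul_zero, cf_zero, norm_zero]
    positivity

/-- The image of `e_1 ^ {k-2} t f(q̃_M)` in `T̃_{n₁,n₂}`, for `f ∈ 𝒦_M⁺⁺`. -/
def eltT (n₂ : ℕ) (f : KPlusPlus p M) : T p M k n₁ n₂ :=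
  ⟨toV p M k n₁ n₂ (elt p M k f.1), elt p M k f.1, elt_mem_N1 p M k f, rfl⟩

end Modules

end EllPolylog

end

/-! The coefficients of `q̃_M ^ r t ^ s e_1 ^ {k-2-j} e_2 ^ j` are coordinates on `T̃_{n₁,n₂} ⊗
ℚ_p`. In these coordinates `∂_{m,2}` is diagonal, with eigenvalue `p ^ m` times the total degree in
`t` and `e_2`, while `∂_{m,1} = p ^ m (t/M q̃_M ∂/∂q̃_M + e_2 ∂/∂e_1)` raises this degree by one
(`isPartial_gammaElt_iff`, `isPartial_uElt_iff`). Because of the twist the least degree is one, and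
it occurs only for `t e_1 ^ {k-2}`.

Hence `e_1 ^ {k-2} t f(q̃_M)` is an eigenvector for `p ^ m`. The image of `∂_{m,1}` has no component
in degree one, so `f` can be read off from the class modulo `∂_{m,1}`; this gives injectivity
(`coV_eq_zero_of_mem_dT`, `toLim₂_injective`).

Conversely, let `(∂_{m,2} - p ^ m) x = ∂_{m,1} w`. In degree `D + 1` the left side is `p ^ m D x`,
and the right side comes from the part of `w` of degree `D`. Dividing that part by `D` makes `p ^ m`
times the part of `x` of degree at least two a value of `∂_{m,1}`. The degrees involved are bounded
in terms of `n₁` and `k`, so the factor `(n₁ + k)!` clears all denominators: modulo `∂_{m,1}`, `p ^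
m (n₁ + k)!` kills the difference between `x` and its degree one part (`smul_cls_eq`).

This factor is independent of `n₂`, so it passes to the limit over `n₂`, and after inverting `p`
each level `n₁ ≥ 1` is isomorphic to `𝒦_M⁺` (`baseChange_toLim₂_bijective`). It depends on `n₁`,
which is why `p` is inverted before the limit over `n₁`; that last limit is the limit of a constant
system (`toLim_bijective`). -/

noncomputable section

namespace EllPolylog

/-! ### Coordinates on the quotients `V`. -/

section Coefficients

variable {p : ℕ} [Fact p.Prime] {M : ℕ}

lemma QT.ext_cf {x y : QT p M} (h : ∀ r s, cf p M r s x = cf p M r s y) : x = y :=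
  PowerSeries.ext fun r => PowerSeries.ext fun s => h r s

lemma cf_smul (r s : ℕ) (c : ℚ_[p]) (x : QT p M) : cf p M r s (c • x) = c • cf p M r s x := rfl

variable (p M) in
/-- The element of `F_M[[q̃_M, t]]` with prescribed coefficients. -/
def ofCf (a : ℕ → ℕ → CycF p M) : QT p M :=
  PowerSeries.mk (R := PowerSeries (CycF p M)) fun r => PowerSeries.mk (a r)

lemma cf_ofCf (a : ℕ → ℕ → CycF p M) (r s : ℕ) : cf p M r s (ofCf p M a) = a r s :=
  (congrArg (PowerSeries.coeff s) (PowerSeries.coeff_mk _ _)).trans (PowerSeries.coeff_mk _ _)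

variable (p M) in
/-- An element of `F_M[[t]]`, as an element of `F_M[[q̃_M, t]]`. -/
def constQ (g : PowerSeries (CycF p M)) : QT p M :=
  PowerSeries.C (R := PowerSeries (CycF p M)) g

lemma cf_C_mul (r s : ℕ) (g : PowerSeries (CycF p M)) (x : QT p M) :
    cf p M r s (constQ p M g * x)
      = PowerSeries.coeff s (g * PowerSeries.coeff (R := PowerSeries (CycF p M)) r x) :=
  congrArg (PowerSeries.coeff s) (PowerSeries.coeff_C_mul r x g)

lemma tt_pow (n : ℕ) : tt p M ^ n
    = constQ p M (PowerSeries.X ^ n) :=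
  (map_pow (PowerSeries.C (R := PowerSeries (CycF p M))) PowerSeries.X n).symm

lemma cf_tt_pow_mul (n r s : ℕ) (x : QT p M) :
    cf p M r s (tt p M ^ n * x) = if n ≤ s then cf p M r (s - n) x else 0 := by
  rw [tt_pow, cf_C_mul, PowerSeries.coeff_X_pow_mul']
  rfl

lemma cf_qq_pow_mul (n r s : ℕ) (x : QT p M) :
    cf p M r s (qq p M ^ n * x) = if n ≤ r then cf p M (r - n) s x else 0 := by
  refine (congrArg (PowerSeries.coeff s)
    (PowerSeries.coeff_X_pow_mul' (R := PowerSeries (CycF p M)) x n r)).trans ?_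
  split_ifs
  · rfl
  · exact map_zero _

lemma cf_tt_mul (r s : ℕ) (x : QT p M) : cf p M r (s + 1) (tt p M * x) = cf p M r s x := by
  simpa using cf_tt_pow_mul 1 r (s + 1) x

lemma cf_tt_mul_zero (r : ℕ) (x : QT p M) : cf p M r 0 (tt p M * x) = 0 := by
  simpa using cf_tt_pow_mul 1 r 0 x

/-- A series whose coefficients of `q̃_M ^ r * t ^ s` with `r < a` and `s < b` vanish belongs to the
ideal `(t ^ b, q̃_M ^ a)`. -/
lemma exists_eq_tt_pow_mul_add (a b : ℕ) (x : QT p M) :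
    ∃ y z : QT p M, (∀ r < a, ∀ s < b, cf p M r s x = 0) →
      x = tt p M ^ b * y + qq p M ^ a * z := by
  -- All terms with `r ≥ a` go to the second summand, so the first is cut off at `r < a`.
  refine ⟨ofCf p M fun r s => if r < a then cf p M r (s + b) x else 0,
    ofCf p M fun r s => cf p M (r + a) s x, fun h => QT.ext_cf fun r s => ?_⟩
  rw [cf_add, cf_tt_pow_mul, cf_qq_pow_mul, cf_ofCf, cf_ofCf]
  by_cases hr : r < a
  · rw [if_neg (by omega : ¬ a ≤ r), if_pos hr, add_zero]
    split_ifs with hs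
    · rw [Nat.sub_add_cancel hs]
    · exact h r hr s (not_le.1 hs)
  · rw [if_neg hr, if_pos (not_lt.1 hr), Nat.sub_add_cancel (not_lt.1 hr), ite_self, zero_add]

variable (k : ℕ)

/-- The exponent of the monomial `e_1 ^ {k-2-j} e_2 ^ j`. -/
def mon (j : ℕ) : Fin 2 →₀ ℕ := Finsupp.single 0 (k - 2 - j) + Finsupp.single 1 j

lemma mon_one (j : ℕ) : mon k j 1 = j := by simp [mon]

lemma mon_zero (j : ℕ) : mon k j 0 = k - 2 - j := by simp [mon]

lemma mon_inj {i j : ℕ} : mon k i = mon k j ↔ i = j :=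
  ⟨fun h => by rw [← mon_one k i, h, mon_one], fun h => by rw [h]⟩

lemma degree_mon {j : ℕ} (hj : j ≤ k - 2) : (mon k j).degree = k - 2 := by
  simp only [mon, map_add, Finsupp.degree_single]
  omega

lemma exists_eq_mon {μ : Fin 2 →₀ ℕ} (h : μ.degree = k - 2) : ∃ j ≤ k - 2, μ = mon k j := by
  have h' : μ 0 + μ 1 = k - 2 := by
    rw [← h, Finsupp.degree_eq_sum, Fin.sum_univ_two]
  refine ⟨μ 1, by omega, Finsupp.ext fun i => ?_⟩
  fin_cases i
  · simp only [Fin.zero_eta, mon_zero]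
    omega
  · simp [mon_one]

variable (p M) in
/-- The element `∑_j a_j e_1 ^ {k-2-j} e_2 ^ j` of `F_M[[q̃_M, t]] ⊗ W_k`. -/
def ofCoeffs (a : ℕ → QT p M) : SymQT p M :=
  ∑ j ∈ Finset.range (k - 2 + 1), MvPolynomial.monomial (mon k j) (a j)

lemma ofCoeffs_mem_W (a : ℕ → QT p M) : ofCoeffs p M k a ∈ W p M k :=
  sum_mem fun j hj => MvPolynomial.isHomogeneous_monomial _
    (degree_mon k (by rw [Finset.mem_range] at hj; omega))

lemma coeff_ofCoeffs (a : ℕ → QT p M) (j : ℕ) :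
    (ofCoeffs p M k a).coeff (mon k j) = if j ≤ k - 2 then a j else 0 := by
  rw [ofCoeffs, MvPolynomial.coeff_sum]
  simp only [MvPolynomial.coeff_monomial, mon_inj, Finset.sum_ite_eq', Finset.mem_range,
    Nat.lt_succ_iff]

lemma W_ext {x y : SymQT p M} (hx : x ∈ W p M k) (hy : y ∈ W p M k)
    (h : ∀ j ≤ k - 2, x.coeff (mon k j) = y.coeff (mon k j)) : x = y := by
  ext1 μ
  by_cases hμ : μ.degree = k - 2
  · obtain ⟨j, hj, rfl⟩ := exists_eq_mon k hμ
    exact h j hj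
  · have hx' : MvPolynomial.IsHomogeneous x (k - 2) := hx
    have hy' : MvPolynomial.IsHomogeneous y (k - 2) := hy
    rw [hx'.coeff_eq_zero hμ, hy'.coeff_eq_zero hμ]

lemma eq_ofCoeffs {x : SymQT p M} (hx : x ∈ W p M k) :
    x = ofCoeffs p M k fun j => x.coeff (mon k j) :=
  W_ext k hx (ofCoeffs_mem_W k _) fun j hj => by rw [coeff_ofCoeffs, if_pos hj]

lemma W1_le_W : W1 p M k ≤ W p M k := by
  rintro _ ⟨y, hy, rfl⟩
  exact mulBy_mem_W M _ hy

lemma coeff_mulBy (a : QT p M) (x : SymQT p M) (μ : Fin 2 →₀ ℕ) :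
    (mulBy p M a x).coeff μ = a * x.coeff μ := by
  rw [LinearMap.mulLeft_apply, MvPolynomial.coeff_C_mul]

variable (p M) in
/-- The coefficient of `q̃_M ^ r t ^ s e_1 ^ {k-2-j} e_2 ^ j`, as a linear form on `W1`. -/
def coW1 (j r s : ℕ) : W1 p M k →ₗ[ℚ_[p]] CycF p M where
  toFun x := cf p M r s (x.1.coeff (mon k j))
  map_add' x y := by
    rw [Submodule.coe_add, MvPolynomial.coeff_add, cf_add]
  map_smul' c x := by
    rw [Submodule.coe_smul, MvPolynomial.coeff_smul, cf_smul, RingHom.id_apply]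

lemma coW1_apply (j r s : ℕ) (x : W1 p M k) :
    coW1 p M k j r s x = cf p M r s (x.1.coeff (mon k j)) := rfl

lemma coW1_zero_right (j r : ℕ) (x : W1 p M k) : coW1 p M k j r 0 x = 0 := by
  obtain ⟨_, y, hy, rfl⟩ := x
  rw [coW1_apply, coeff_mulBy, cf_tt_mul_zero]

variable (p M) in
/-- The element `t ∑_j ∑_{r,s} a_{j,r,s} q̃_M ^ r t ^ s e_1 ^ {k-2-j} e_2 ^ j` of `W1`. -/
def mkW1 (a : ℕ → ℕ → ℕ → CycF p M) : W1 p M k :=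
  ⟨mulBy p M (tt p M) (ofCoeffs p M k fun j => ofCf p M (a j)), _, ofCoeffs_mem_W k _, rfl⟩

lemma coW1_mkW1 (a : ℕ → ℕ → ℕ → CycF p M) (j r s : ℕ) :
    coW1 p M k j r (s + 1) (mkW1 p M k a) = if j ≤ k - 2 then a j r s else 0 := by
  rw [coW1_apply, mkW1, coeff_mulBy, cf_tt_mul, coeff_ofCoeffs]
  split_ifs
  · rw [cf_ofCf]
  · rw [cf_zero]

lemma mkW1_mem_N1 {a : ℕ → ℕ → ℕ → CycF p M}
    (ha : ∀ j r s, ‖a j r s‖ ≤ (p : ℝ) ^ ((r : ℝ) / M)) : (mkW1 p M k a).1 ∈ N1 p M k := by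
  refine ⟨_, ⟨ofCoeffs_mem_W k fun j => ofCf p M (a j), fun μ r s => ?_⟩, rfl⟩
  have h0 : (0 : ℝ) ≤ (p : ℝ) ^ ((r : ℝ) / M) := by positivity
  by_cases hμ : μ.degree = k - 2
  · obtain ⟨j, hj, rfl⟩ := exists_eq_mon k hμ
    rw [coeff_ofCoeffs, if_pos hj, cf_ofCf]
    exact ha j r s
  · have h : MvPolynomial.IsHomogeneous (ofCoeffs p M k fun j => ofCf p M (a j)) (k - 2) :=
      ofCoeffs_mem_W k _
    rw [h.coeff_eq_zero hμ, cf_zero, norm_zero]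
    exact h0

lemma norm_coW1_le {x : W1 p M k} (hx : x.1 ∈ N1 p M k) (j r s : ℕ) :
    ‖coW1 p M k j r s x‖ ≤ (p : ℝ) ^ ((r : ℝ) / M) := by
  obtain ⟨y, hy, hyx⟩ := hx
  have h0 : (0 : ℝ) ≤ (p : ℝ) ^ ((r : ℝ) / M) := by positivity
  cases s with
  | zero => rwa [coW1_zero_right, norm_zero]
  | succ s =>
    have : cf p M r (s + 1) (x.1.coeff (mon k j)) = cf p M r s (y.coeff (mon k j)) := by
      rw [← hyx]
      exact (congrArg _ (coeff_mulBy _ _ _)).trans (cf_tt_mul _ _ _)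
    rw [coW1_apply, this]
    exact hy.2 _ _ _

variable (n₁ n₂ : ℕ)

/-- By the twist `W1` starts in degree one in `t`, so `t ^ n₁ W1` starts in degree `n₁ + 1`: hence
the range `s ≤ n₁`. Together with `coW1_eq_zero_of_mem_J`, this makes the remaining coefficients
coordinates on `V`. -/
lemma mem_J_of_coW1_eq_zero (x : W1 p M k)
    (h : ∀ j ≤ k - 2, ∀ r < M * n₂, ∀ s ≤ n₁, coW1 p M k j r s x = 0) :
    x.1 ∈ J p M k n₁ n₂ := by
  obtain ⟨_, y, hy, rfl⟩ := x
  -- The vanishing condition sits inside the existential, so `u j` and `v j` exist for every `j`,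
  -- even where `h` says nothing.
  choose! u v huv using fun j => exists_eq_tt_pow_mul_add (M * n₂) n₁ (y.coeff (mon k j))
  have hy' : y = mulBy p M (tt p M ^ n₁) (ofCoeffs p M k u)
      + mulBy p M ((qq p M ^ M) ^ n₂) (ofCoeffs p M k v) := by
    refine W_ext k hy (add_mem (mulBy_mem_W M _ (ofCoeffs_mem_W k _))
      (mulBy_mem_W M _ (ofCoeffs_mem_W k _))) fun j hj => ?_
    rw [MvPolynomial.coeff_add, coeff_mulBy, coeff_mulBy, coeff_ofCoeffs, coeff_ofCoeffs,
      if_pos hj, if_pos hj, ← pow_mul]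
    refine huv j fun r hr s hs => ?_
    have := h j hj r hr (s + 1) hs
    rwa [coW1_apply, coeff_mulBy, cf_tt_mul] at this
  have hc (a b : QT p M) (z : SymQT p M) :
      mulBy p M a (mulBy p M b z) = mulBy p M b (mulBy p M a z) := by
    rw [mulBy_mulBy, mulBy_mulBy, mul_comm]
  change mulBy p M (tt p M) y ∈ _
  rw [hy', map_add, hc, hc (tt p M)]
  exact Submodule.add_mem_sup ⟨_, ⟨_, ofCoeffs_mem_W k _, rfl⟩, rfl⟩
    ⟨_, ⟨_, ofCoeffs_mem_W k _, rfl⟩, rfl⟩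

lemma coW1_eq_zero_of_mem_J {x : W1 p M k} (hx : x.1 ∈ J p M k n₁ n₂) (j : ℕ) {r s : ℕ}
    (hr : r < M * n₂) (hs : s ≤ n₁) : coW1 p M k j r s x = 0 := by
  obtain ⟨_, ⟨_, ⟨y, hy, rfl⟩, rfl⟩, _, ⟨z, hz, rfl⟩, e⟩ := Submodule.mem_sup.1 hx
  rw [coW1_apply, ← e, MvPolynomial.coeff_add, coeff_mulBy, coeff_mulBy, coeff_mulBy, cf_add,
    ← pow_mul, cf_tt_pow_mul, cf_qq_pow_mul, if_neg (by omega : ¬ M * n₂ ≤ r), add_zero]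
  split_ifs with h
  · rw [Nat.sub_eq_zero_of_le hs, cf_tt_mul_zero]
  · rfl

variable (p M) in
/-- The coefficient of `q̃_M ^ r t ^ s e_1 ^ {k-2-j} e_2 ^ j`, as a linear form on `V_{n₁,n₂}`; it is
zero by convention unless `r < M n₂` and `s ≤ n₁`. -/
def coV (j r s : ℕ) : V p M k n₁ n₂ →ₗ[ℚ_[p]] CycF p M :=
  Submodule.liftQ ((J p M k n₁ n₂).submoduleOf (W1 p M k))
    (if r < M * n₂ ∧ s ≤ n₁ then coW1 p M k j r s else 0) fun x hx => by
      rw [LinearMap.mem_ker]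
      split_ifs with h
      · exact coW1_eq_zero_of_mem_J k n₁ n₂ hx j h.1 h.2
      · rfl

variable {n₁ n₂}

lemma coV_toV (j : ℕ) {r s : ℕ} (hr : r < M * n₂) (hs : s ≤ n₁) (x : W1 p M k) :
    coV p M k n₁ n₂ j r s (toV p M k n₁ n₂ x) = coW1 p M k j r s x := by
  refine (Submodule.liftQ_apply _ _ _).trans ?_
  rw [if_pos ⟨hr, hs⟩]

/-- Exponents `s + 1` suffice, since the coefficient of `t ^ 0` vanishes on `W1`. -/
lemma V_ext {x y : V p M k n₁ n₂}
    (h : ∀ j ≤ k - 2, ∀ r < M * n₂, ∀ s < n₁,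
      coV p M k n₁ n₂ j r (s + 1) x = coV p M k n₁ n₂ j r (s + 1) y) : x = y := by
  rw [← sub_eq_zero]
  obtain ⟨w, hw⟩ := toV_surjective (x - y)
  rw [← hw]
  refine (Submodule.Quotient.mk_eq_zero _).2 (mem_J_of_coW1_eq_zero k n₁ n₂ w ?_)
  intro j hj r hr s hs
  cases s with
  | zero => exact coW1_zero_right k j r w
  | succ s => rw [← coV_toV k j hr hs, hw, map_sub, h j hj r hr s hs, sub_self]

lemma norm_coV_le {x : V p M k n₁ n₂} (hx : x ∈ T p M k n₁ n₂) (j : ℕ) {r s : ℕ}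
    (hr : r < M * n₂) (hs : s ≤ n₁) :
    ‖coV p M k n₁ n₂ j r s x‖ ≤ (p : ℝ) ^ ((r : ℝ) / M) := by
  obtain ⟨y, hy, rfl⟩ := hx
  refine (congrArg norm (coV_toV k j hr hs y)).trans_le (norm_coW1_le k hy j r s)

lemma coV_tr {n₁' n₂' : ℕ} (h₁ : n₁ ≤ n₁') (h₂ : n₂ ≤ n₂') (j : ℕ) {r s : ℕ}
    (hr : r < M * n₂) (hs : s ≤ n₁) (x : V p M k n₁' n₂') :
    coV p M k n₁ n₂ j r s (tr h₁ h₂ x) = coV p M k n₁' n₂' j r s x := by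
  obtain ⟨w, rfl⟩ := toV_surjective x
  rw [tr_toV, coV_toV k j hr hs, coV_toV k j (hr.trans_le (Nat.mul_le_mul_left M h₂))
    (hs.trans h₁)]

lemma coW1_elt (f : PowerSeries (CycF p M)) (j r s : ℕ) :
    coW1 p M k j r (s + 1) (elt p M k f)
      = if j = 0 ∧ s = 0 then PowerSeries.coeff r f else 0 := by
  have h : cf p M r s (evalQ p M f)
      = PowerSeries.coeff s (PowerSeries.C (PowerSeries.coeff r f)) :=
    congrArg (PowerSeries.coeff s) (PowerSeries.coeff_map _ _ _)
  have h0 : Finsupp.single (0 : Fin 2) (k - 2) = mon k 0 := by simp [mon]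
  rw [coW1_apply, elt, coeff_mulBy, coeff_mulBy, cf_tt_mul, MvPolynomial.coeff_X_pow, h0]
  simp only [mon_inj]
  rcases eq_or_ne j 0 with rfl | hj
  · rw [if_pos rfl, mul_one, h, PowerSeries.coeff_C]
    simp
  · rw [if_neg hj.symm, mul_zero, cf_zero, if_neg (fun h => hj h.1)]

end Coefficients

/-! ### The `p`-adic exponential on `p ^ m ℤ_p`. -/

section Exponential

variable (p : ℕ) [Fact p.Prime] (m : ℕ)

/-- From `2 v_p(n!) + n ≤ 2 m n` one gets `‖1 / n!‖ ≤ p ^ ((m - 1/2) n)`. The margin `1/2` puts the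
elements of norm at most `p ^ (-m)` strictly inside the disc. -/
lemma rpow_le_radius_expSeries (hm : padicValNat p (2 * p) ≤ m) :
    ENNReal.ofReal ((p : ℝ) ^ (1 / 2 - m : ℝ)) ≤ (NormedSpace.expSeries ℚ_[p] ℚ_[p]).radius := by
  have hp : (1 : ℝ) < p := by exact_mod_cast (Fact.out : p.Prime).one_lt
  refine FormalMultilinearSeries.le_radius_of_bound _ 1 fun n => ?_
  rw [Real.coe_toNNReal _ (by positivity), NormedSpace.expSeries, norm_smul,
    ContinuousMultilinearMap.norm_mkPiAlgebraFin, mul_one]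
  -- With exponent `0` the numerator is `1`, and the formula computes `‖1 / n!‖`.
  have h := norm_exp_term p 0 n
  rw [pow_zero, one_pow, one_div] at h
  rw [h, ← Real.rpow_intCast, ← Real.rpow_mul_natCast (by positivity),
    ← Real.rpow_add (by positivity)]
  apply Real.rpow_le_one_of_one_le_of_nonpos hp.le
  have h' : (2 * padicValNat p n.factorial + n : ℝ) ≤ 2 * (m * n) := by
    exact_mod_cast two_mul_padicValNat_factorial_le p m hm n
  rw [Int.cast_sub, Int.cast_natCast, Int.cast_natCast, zero_mul, Nat.cast_zero]
  linarith

lemma mem_eball_expSeries (hm : padicValNat p (2 * p) ≤ m) {x : ℚ_[p]}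
    (hx : ‖x‖ ≤ (p : ℝ) ^ (-(m : ℤ))) :
    x ∈ Metric.eball (0 : ℚ_[p]) (NormedSpace.expSeries ℚ_[p] ℚ_[p]).radius := by
  have hp : (1 : ℝ) < p := by exact_mod_cast (Fact.out : p.Prime).one_lt
  refine Metric.eball_subset_eball (rpow_le_radius_expSeries p m hm) ?_
  rw [Metric.mem_eball, edist_zero_right, ← ofReal_norm]
  refine (ENNReal.ofReal_lt_ofReal_iff (by positivity)).2 (hx.trans_lt ?_)
  rw [← Real.rpow_intCast]
  apply Real.rpow_lt_rpow_of_exponent_lt hp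
  push_cast
  linarith

lemma hasDerivAt_exp_zero (hm : padicValNat p (2 * p) ≤ m) :
    HasDerivAt (NormedSpace.exp : ℚ_[p] → ℚ_[p]) 1 0 := by
  have hp : (1 : ℝ) < p := by exact_mod_cast (Fact.out : p.Prime).one_lt
  refine hasDerivAt_exp_zero_of_radius_pos (lt_of_lt_of_le ?_ (rpow_le_radius_expSeries p m hm))
  rw [ENNReal.ofReal_pos]
  positivity

/-- For `N = p ^ n` this turns the `p ^ n`-th power of `e ^ {p ^ m}` into the value at `β = p ^ n`
of the analytic function `exp(β p ^ m)`. -/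
lemma exp_natCast_mul_pow (hm : padicValNat p (2 * p) ≤ m) (N : ℕ) :
    NormedSpace.exp ((N : ℚ_[p]) * (p : ℚ_[p]) ^ m) = NormedSpace.exp ((p : ℚ_[p]) ^ m) ^ N := by
  have hx : ‖(p : ℚ_[p]) ^ m‖ = (p : ℝ) ^ (-(m : ℤ)) := by
    rw [norm_pow, Padic.norm_p, zpow_neg, zpow_natCast, inv_pow]
  induction N with
  | zero => simp
  | succ N ih =>
    rw [pow_succ, ← ih, ← NormedSpace.exp_add_of_mem_ball (𝕂 := ℚ_[p])
      (mem_eball_expSeries p m hm _) (mem_eball_expSeries p m hm hx.le)]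
    · push_cast
      ring_nf
    · rw [norm_mul, hx]
      refine mul_le_of_le_one_left (by positivity) ?_
      exact_mod_cast Padic.norm_int_le_one (p := p) N

end Exponential

/-! ### Powers of the two generators. -/

section PowersOfElements

variable (p : ℕ) [Fact p.Prime] (m : ℕ)

lemma uElt_pow (N : ℕ) : (((uElt p m ^ N : Pm p m) : GL (Fin 2) ℤ_[p]) :
    Matrix (Fin 2) (Fin 2) ℤ_[p]) = !![1, N * (p : ℤ_[p]) ^ m; 0, 1] := by
  induction N with
  | zero =>
    ext i j
    fin_cases i <;> fin_cases j <;> simp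
  | succ N ih =>
    rw [pow_succ, Subgroup.coe_mul, Units.val_mul, ih]
    have : ((uElt p m : GL (Fin 2) ℤ_[p]) : Matrix (Fin 2) (Fin 2) ℤ_[p])
      = !![1, (p : ℤ_[p]) ^ m; 0, 1] := rfl
    rw [this]
    ext i j
    fin_cases i <;> fin_cases j <;> simp [Matrix.mul_apply, Fin.sum_univ_two]
    ring

lemma gammaElt_pow (hm : padicValNat p (2 * p) ≤ m) (N : ℕ) :
    (((gammaElt p m hm ^ N : Pm p m) : GL (Fin 2) ℤ_[p]) :
    Matrix (Fin 2) (Fin 2) ℤ_[p]) = !![1, 0; 0, expP p m hm ^ N] := by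
  induction N with
  | zero =>
    ext i j
    fin_cases i <;> fin_cases j <;> simp
  | succ N ih =>
    rw [pow_succ, Subgroup.coe_mul, Units.val_mul, ih]
    have : ((gammaElt p m hm : GL (Fin 2) ℤ_[p]) : Matrix (Fin 2) (Fin 2) ℤ_[p])
      = !![1, 0; 0, expP p m hm] := rfl
    rw [this]
    ext i j
    fin_cases i <;> fin_cases j <;> simp [Matrix.mul_apply, Fin.sum_univ_two, pow_succ]

end PowersOfElements

/-! ### The action of `P_m` in coordinates. -/

section ActionOnCoefficients

variable {p : ℕ} [Fact p.Prime] {M m : ℕ} (k : ℕ)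

/-- Since `q̃_M ^ r` is multiplied by `exp(b t / M) ^ r = exp(r b t / M)`, the exponent `r` is
preserved, and only a Cauchy product in `t` remains. -/
lemma cf_actQT (g : Pm p m) (x : QT p M) (r s : ℕ) :
    cf p M r s (actQT M g x) = ∑ hl ∈ Finset.HasAntidiagonal.antidiagonal s,
      (algebraMap ℤ_[p] (CycF p M) (g.1 0 1) / (M : CycF p M)) ^ hl.1
        * ((r : CycF p M) ^ hl.1 * algebraMap ℚ (CycF p M) (1 / (hl.1.factorial : ℚ)))
        * (algebraMap ℤ_[p] (CycF p M) (g.1 1 1) ^ hl.2 * cf p M r hl.2 x) := by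
  set b := algebraMap ℤ_[p] (CycF p M) (g.1 0 1)
  set d := algebraMap ℤ_[p] (CycF p M) (g.1 1 1)
  have h : PowerSeries.coeff (R := PowerSeries (CycF p M)) r (actQT M g x)
      = PowerSeries.rescale (b / (M : CycF p M))
          (PowerSeries.rescale (r : CycF p M) (PowerSeries.exp (CycF p M)))
        * PowerSeries.rescale d (PowerSeries.coeff (R := PowerSeries (CycF p M)) r x) := by
    rw [← PowerSeries.exp_pow_eq_rescale_exp, map_pow]
    exact (PowerSeries.coeff_rescale _ _ _).trans
      (congrArg (_ * ·) (PowerSeries.coeff_map _ _ _))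
  refine (congrArg (PowerSeries.coeff s) h).trans ?_
  rw [PowerSeries.coeff_mul]
  refine Finset.sum_congr rfl fun hl _ => ?_
  rw [PowerSeries.coeff_rescale, PowerSeries.coeff_rescale, PowerSeries.coeff_rescale,
    PowerSeries.coeff_exp]
  rfl

/-- Binomial expansion of the image of `e_1 ^ {k-2-i} e_2 ^ i`; the exponent of `e_2` never
decreases. -/
lemma coeff_add_pow_mul_pow {R : Type*} [CommRing R] (b d : R) {i j : ℕ} (hi : i ≤ k - 2)
    (hj : j ≤ k - 2) :
    (((MvPolynomial.X 0 : MvPolynomial (Fin 2) R) + MvPolynomial.C b * MvPolynomial.X 1)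
      ^ (k - 2 - i) * (MvPolynomial.C d * MvPolynomial.X 1) ^ i).coeff (mon k j)
      = if i ≤ j then b ^ (j - i) * d ^ i * ((k - 2 - i).choose (j - i) : R) else 0 := by
  rw [add_comm, add_pow, Finset.sum_mul, MvPolynomial.coeff_sum]
  have h : ∀ l ∈ Finset.range (k - 2 - i + 1),
      ((MvPolynomial.C b * MvPolynomial.X 1) ^ l * (MvPolynomial.X 0 : MvPolynomial (Fin 2) R)
        ^ (k - 2 - i - l) * ((k - 2 - i).choose l : MvPolynomial (Fin 2) R)
        * (MvPolynomial.C d * MvPolynomial.X 1) ^ i).coeff (mon k j)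
      = if l + i = j then b ^ l * d ^ i * ((k - 2 - i).choose l : R) else 0 := by
    intro l hl
    have e : (MvPolynomial.C b * MvPolynomial.X 1) ^ l * (MvPolynomial.X 0 : MvPolynomial (Fin 2) R)
        ^ (k - 2 - i - l) * ((k - 2 - i).choose l : MvPolynomial (Fin 2) R)
        * (MvPolynomial.C d * MvPolynomial.X 1) ^ i
        = MvPolynomial.monomial (mon k (l + i)) (b ^ l * d ^ i * ((k - 2 - i).choose l : R)) := by
      rw [MvPolynomial.monomial_eq, Finsupp.prod_fintype _ _ (by simp), Fin.prod_univ_two, mon_zero,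
        mon_one,
        Nat.sub_sub, add_comm i l]
      simp only [map_mul, map_pow, map_natCast]
      ring
    rw [e, MvPolynomial.coeff_monomial]
    simp only [mon_inj]
  rw [Finset.sum_congr rfl h]
  split_ifs with hij
  · rw [Finset.sum_eq_single (j - i), if_pos (by omega)]
    · intro l _ hl
      rw [if_neg (by omega)]
    · intro hl
      rw [Finset.mem_range] at hl
      omega
  · exact Finset.sum_eq_zero fun l _ => if_neg (by omega)

lemma cf_mul_natCast_mul {x : QT p M} (r s : ℕ) (c : ℤ_[p]) (n : ℕ) :
    cf p M r s (x * (algebraMap ℤ_[p] (QT p M) c * (n : QT p M)))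
      = cf p M r s x * (algebraMap ℤ_[p] (CycF p M) c * (n : CycF p M)) := by
  have h : algebraMap ℤ_[p] (QT p M) c * (n : QT p M)
      = constQ p M (PowerSeries.C (algebraMap ℤ_[p] (CycF p M) c * (n : CycF p M))) := by
    have h1 : algebraMap ℤ_[p] (QT p M) c
      = constQ p M (PowerSeries.C (algebraMap ℤ_[p] (CycF p M) c)) := algebraMap_QT M c
    have h2 : (n : QT p M) = constQ p M (PowerSeries.C (n : CycF p M)) :=
      ((congrArg (PowerSeries.C (R := PowerSeries (CycF p M))) (map_natCast _ n)).trans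
        (map_natCast _ n)).symm
    rw [h1, h2, map_mul]
    exact (map_mul (PowerSeries.C (R := PowerSeries (CycF p M))) _ _).symm
  rw [h, mul_comm, cf_C_mul, PowerSeries.coeff_C_mul, mul_comm]
  rfl

lemma coW1_actW1 (g : Pm p m) (x : W1 p M k) {j : ℕ} (hj : j ≤ k - 2) (r s : ℕ) :
    coW1 p M k j r s (actW1 M g x) = ∑ i ∈ Finset.range (k - 2 + 1), if i ≤ j then
      (∑ hl ∈ Finset.HasAntidiagonal.antidiagonal s,
        (algebraMap ℤ_[p] (CycF p M) (g.1 0 1) / (M : CycF p M)) ^ hl.1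
        * ((r : CycF p M) ^ hl.1 * algebraMap ℚ (CycF p M) (1 / (hl.1.factorial : ℚ)))
        * (algebraMap ℤ_[p] (CycF p M) (g.1 1 1) ^ hl.2 * coW1 p M k i r hl.2 x))
      * (algebraMap ℤ_[p] (CycF p M) (g.1 0 1 ^ (j - i) * g.1 1 1 ^ i)
        * ((k - 2 - i).choose (j - i) : CycF p M)) else 0 := by
  have h : (actW1 M g x).1 = ∑ i ∈ Finset.range (k - 2 + 1),
      MvPolynomial.C (actQT M g (x.1.coeff (mon k i))) *
        (((MvPolynomial.X 0 : SymQT p M)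
          + MvPolynomial.C (algebraMap ℤ_[p] (QT p M) (g.1 0 1)) * MvPolynomial.X 1)
            ^ (k - 2 - i)
          * (MvPolynomial.C (algebraMap ℤ_[p] (QT p M) (g.1 1 1)) * MvPolynomial.X 1) ^ i) := by
    change act M g x.1 = _
    conv_lhs => rw [eq_ofCoeffs k (W1_le_W k x.2), ofCoeffs, map_sum]
    refine Finset.sum_congr rfl fun i _ => ?_
    rw [act, MvPolynomial.coe_eval₂Hom, MvPolynomial.eval₂_monomial,
      Finsupp.prod_fintype _ _ (by simp), Fin.prod_univ_two, mon_zero, mon_one]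
    rfl
  rw [coW1_apply, h, MvPolynomial.coeff_sum]
  have hsum (S : Finset ℕ) (F : ℕ → QT p M) :
      cf p M r s (∑ i ∈ S, F i) = ∑ i ∈ S, cf p M r s (F i) :=
    map_sum (AddMonoidHom.mk' (cf p M r s) (cf_add p M r s)) F S
  rw [hsum]
  refine Finset.sum_congr rfl fun i hi => ?_
  rw [Finset.mem_range] at hi
  rw [MvPolynomial.coeff_C_mul, coeff_add_pow_mul_pow k _ _ (by omega) hj]
  split_ifs
  · rw [← map_pow, ← map_pow, ← map_mul, cf_mul_natCast_mul, cf_actQT]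
    rfl
  · rw [mul_zero, cf_zero]

end ActionOnCoefficients

/-! ### The operators `∂_{m,1}` and `∂_{m,2}` in coordinates. -/

section Derivatives

variable {p : ℕ} [Fact p.Prime] {M m : ℕ} (k : ℕ)

lemma finiteDimensional_CycF (hM : 1 ≤ M) : FiniteDimensional ℚ_[p] (CycF p M) := by
  have : Finite {z : PadicAlgCl p | z ^ M = 1} := by
    classical
    refine Set.Finite.subset (Polynomial.nthRoots M (1 : PadicAlgCl p)).toFinset.finite_toSet ?_
    intro z hz
    rw [Finset.mem_coe, Multiset.mem_toFinset, Polynomial.mem_nthRoots (by omega)]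
    exact hz
  exact IntermediateField.finiteDimensional_adjoin fun x _ => Algebra.IsIntegral.isIntegral x

variable {n₁ n₂ : ℕ}

/-- The canonical topology of `V_{n₁,n₂}` is the one of the convergence of coefficients. -/
lemma tendsto_V_iff (hM : 1 ≤ M) (u : ℕ → V p M k n₁ n₂) (y : V p M k n₁ n₂) :
    Tendsto u atTop (@nhds _ (moduleTopology ℚ_[p] (V p M k n₁ n₂)) y) ↔
      ∀ j ≤ k - 2, ∀ r < M * n₂, ∀ s < n₁,
        Tendsto (fun n => coV p M k n₁ n₂ j r (s + 1) (u n)) atTop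
          (𝓝 (coV p M k n₁ n₂ j r (s + 1) y)) := by
  let _ := moduleTopology ℚ_[p] (V p M k n₁ n₂)
  have : IsModuleTopology ℚ_[p] (V p M k n₁ n₂) := ⟨rfl⟩
  have := ModuleTopology.continuousSMul ℚ_[p] (V p M k n₁ n₂)
  have := ModuleTopology.continuousAdd ℚ_[p] (V p M k n₁ n₂)
  have := IsModuleTopology.topologicalAddGroup ℚ_[p] (V p M k n₁ n₂)
  have := finiteDimensional_CycF (p := p) hM
  constructor
  · intro h j _ r _ s _
    exact ((IsModuleTopology.continuous_of_linearMap
      (coV p M k n₁ n₂ j r (s + 1))).tendsto y).comp h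
  · intro h
    -- The coordinates embed `V` in a finite-dimensional space, where a linear left inverse is
    -- continuous and carries convergence back to `V`.
    let φ : V p M k n₁ n₂ →ₗ[ℚ_[p]] (Fin (k - 2 + 1) × Fin (M * n₂) × Fin n₁ → CycF p M) :=
      LinearMap.pi fun i => coV p M k n₁ n₂ i.1 i.2.1 (i.2.2 + 1)
    have hφ : LinearMap.ker φ = ⊥ := by
      refine LinearMap.ker_eq_bot.2 fun x y hxy => V_ext k fun j hj r hr s hs => ?_
      exact congrFun hxy (⟨j, Nat.lt_succ_of_le hj⟩, ⟨r, hr⟩, ⟨s, hs⟩)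
    obtain ⟨ψ, hψ⟩ := φ.exists_leftInverse_of_injective hφ
    have hψ' (x) : ψ (φ x) = x := LinearMap.congr_fun hψ x
    have h1 : Tendsto (fun n => φ (u n)) atTop (𝓝 (φ y)) :=
      tendsto_pi_nhds.2 fun i => h _ (Nat.lt_succ_iff.1 i.1.2) _ i.2.1.2 _ i.2.2.2
    have h2 := ((LinearMap.continuous_of_finiteDimensional ψ).tendsto (φ y)).comp h1
    rw [hψ'] at h2
    exact h2.congr fun n => hψ' _

lemma tendsto_of_hasDerivAt {f : ℚ_[p] → CycF p M} {f' : CycF p M} (h : HasDerivAt f f' 0) :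
    Tendsto (fun n : ℕ => ((p : ℚ_[p]) ^ n)⁻¹ • (f ((p : ℚ_[p]) ^ n) - f 0)) atTop (𝓝 f') := by
  have hp : (p : ℚ_[p]) ≠ 0 := by exact_mod_cast (Fact.out : p.Prime).ne_zero
  have h1 : Tendsto (fun n : ℕ => (p : ℚ_[p]) ^ n) atTop (𝓝[≠] 0) := by
    refine tendsto_nhdsWithin_iff.2 ⟨tendsto_pow_atTop_nhds_zero_of_norm_lt_one
      Padic.norm_p_lt_one, Eventually.of_forall fun n => pow_ne_zero n hp⟩
  refine ((hasDerivAt_iff_tendsto_slope_zero.1 h).comp h1).congr fun n => ?_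
  simp only [Function.comp_apply, zero_add]

/-- If the coordinates of `x * g ^ {p ^ n}` are values at `β = p ^ n` of functions differentiable at
`0`, the limit defining `∂_g` is their derivative, since `p ^ n` tends to `0`. -/
lemma isPartial_iff_of_hasDerivAt (hM : 1 ≤ M) {g : Pm p m} (x y : V p M k n₁ n₂)
    (f : ℕ → ℕ → ℕ → ℚ_[p] → CycF p M) (f' : ℕ → ℕ → ℕ → CycF p M)
    (hf : ∀ j ≤ k - 2, ∀ r < M * n₂, ∀ s < n₁, HasDerivAt (f j r s) (f' j r s) 0)
    (h0 : ∀ j ≤ k - 2, ∀ r < M * n₂, ∀ s < n₁, f j r s 0 = coV p M k n₁ n₂ j r (s + 1) x)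
    (hn : ∀ j ≤ k - 2, ∀ r < M * n₂, ∀ s < n₁, ∀ n, f j r s ((p : ℚ_[p]) ^ n)
      = coV p M k n₁ n₂ j r (s + 1) (rho M n₁ n₂ (g ^ p ^ n) x)) :
    IsPartial M n₁ n₂ g x y ↔ ∀ j ≤ k - 2, ∀ r < M * n₂, ∀ s < n₁,
      coV p M k n₁ n₂ j r (s + 1) y = f' j r s := by
  rw [IsPartial, tendsto_V_iff k hM]
  refine forall₂_congr fun j hj => forall₂_congr fun r hr => forall₂_congr fun s hs => ?_
  have h := tendsto_of_hasDerivAt (hf j hj r hr s hs)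
  have h' : Tendsto (fun n : ℕ => coV p M k n₁ n₂ j r (s + 1) (((p : ℚ_[p]) ^ n)⁻¹ •
      (rho M n₁ n₂ (g ^ p ^ n) x - x))) atTop (𝓝 (f' j r s)) := by
    refine h.congr fun n => ?_
    rw [map_smul, map_sub, hn j hj r hr s hs, h0 j hj r hr s hs]
  exact ⟨fun h'' => tendsto_nhds_unique h'' h', fun e => e ▸ h'⟩

lemma hasDerivAt_pow_smul (e : ℕ) (c : CycF p M) :
    HasDerivAt (fun β : ℚ_[p] => β ^ e • c) (if e = 1 then c else 0) 0 := by
  refine ((hasDerivAt_pow e (0 : ℚ_[p])).smul_const c).congr_deriv ?_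
  rcases e with _ | _ | e <;> simp

lemma sum_ite_add_eq_zero {A : Type*} [AddCommMonoid A] (K : ℕ → ℕ → ℕ → A) {n j : ℕ}
    (hj : j ≤ n) (s : ℕ) :
    (∑ i ∈ Finset.range (n + 1), if i ≤ j then ∑ hl ∈ Finset.HasAntidiagonal.antidiagonal s,
      if hl.1 + (j - i) = 0 then K i hl.1 hl.2 else 0 else 0) = K j 0 s := by
  rw [Finset.sum_eq_single j, if_pos le_rfl, Finset.sum_eq_single (0, s)]
  · simp
  · rintro ⟨h, l⟩ hl hne
    rw [Finset.HasAntidiagonal.mem_antidiagonal] at hl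
    refine if_neg fun h0 => hne ?_
    simp only at hl h0
    exact Prod.ext (by simp only; omega) (by simp only; omega)
  · simp
  · intro i _ hij
    split_ifs
    · exact Finset.sum_eq_zero fun hl _ => if_neg (by omega)
    · rfl
  · simp
    omega

/-- The linear term in `β` has two sources: `h = 1`, `i = j` from the exponential, and `h = 0`, `i =
j - 1` from the binomial, the latter absent for `j = 0`. -/
lemma sum_ite_add_eq_one {A : Type*} [AddCommMonoid A] (K : ℕ → ℕ → ℕ → A) {n j : ℕ}
    (hj : j ≤ n) (s : ℕ) :
    (∑ i ∈ Finset.range (n + 1), if i ≤ j then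
      ∑ hl ∈ Finset.HasAntidiagonal.antidiagonal (s + 1),
        if hl.1 + (j - i) = 1 then K i hl.1 hl.2 else 0 else 0)
      = K j 1 s + if j = 0 then 0 else K (j - 1) 0 (s + 1) := by
  have h1 : (∑ hl ∈ Finset.HasAntidiagonal.antidiagonal (s + 1),
      if hl.1 + (j - j) = 1 then K j hl.1 hl.2 else 0) = K j 1 s := by
    rw [Finset.sum_eq_single (1, s)]
    · simp
    · rintro ⟨h, l⟩ hl hne
      rw [Finset.HasAntidiagonal.mem_antidiagonal] at hl
      refine if_neg fun h0 => hne ?_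
      simp only at hl h0
      exact Prod.ext (by simp only; omega) (by simp only; omega)
    · intro h
      rw [Finset.HasAntidiagonal.mem_antidiagonal] at h
      omega
  rcases Nat.eq_zero_or_pos j with rfl | hj0
  · rw [Finset.sum_eq_single 0, if_pos le_rfl, if_pos rfl, add_zero, h1]
    · intro i _ hi
      exact if_neg (by omega)
    · simp
  · rw [Finset.sum_eq_add j (j - 1) (by omega), if_pos le_rfl, h1, if_pos (by omega),
      if_neg (by omega)]
    · congr 1
      rw [Finset.sum_eq_single (0, s + 1)]
      · simp only
        rw [if_pos (by omega)]
      · rintro ⟨h, l⟩ hl hne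
        rw [Finset.HasAntidiagonal.mem_antidiagonal] at hl
        refine if_neg fun h0 => hne ?_
        simp only at hl h0
        exact Prod.ext (by simp only; omega) (by simp only; omega)
      · intro h
        rw [Finset.HasAntidiagonal.mem_antidiagonal] at h
        omega
    · intro i _ hi
      split_ifs
      · exact Finset.sum_eq_zero fun hl _ => if_neg (by omega)
      · rfl
    · intro h
      rw [Finset.mem_range] at h
      omega
    · intro h
      rw [Finset.mem_range] at h
      omega

variable {k}

/-- `∂_{m,1} = p ^ m (t / M q̃_M ∂/∂q̃_M + e_2 ∂/∂e_1)`. -/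
lemma isPartial_uElt_iff (hM : 1 ≤ M) (x y : V p M k n₁ n₂) :
    IsPartial M n₁ n₂ (uElt p m) x y ↔ ∀ j ≤ k - 2, ∀ r < M * n₂, ∀ s < n₁,
      coV p M k n₁ n₂ j r (s + 1) y =
        (p : CycF p M) ^ m / (M : CycF p M) * (r : CycF p M) * coV p M k n₁ n₂ j r s x
        + if j = 0 then 0 else (p : CycF p M) ^ m * ((k - 2 - (j - 1) : ℕ) : CycF p M)
          * coV p M k n₁ n₂ (j - 1) r (s + 1) x := by
  obtain ⟨w, rfl⟩ := toV_surjective x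
  -- For `b = β p ^ m` and `d = 1`, this is the factor of `β ^ (h + (j - i))` in the action formula.
  let K (j r i h l : ℕ) : CycF p M := ((p : CycF p M) ^ m / (M : CycF p M)) ^ h
    * ((r : CycF p M) ^ h * algebraMap ℚ (CycF p M) (1 / (h.factorial : ℚ)))
    * coW1 p M k i r l w
    * (((p : CycF p M) ^ m) ^ (j - i) * ((k - 2 - i).choose (j - i) : CycF p M))
  refine (isPartial_iff_of_hasDerivAt k hM _ y
    (fun j r s β => ∑ i ∈ Finset.range (k - 2 + 1), if i ≤ j then
      ∑ hl ∈ Finset.HasAntidiagonal.antidiagonal (s + 1),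
        β ^ (hl.1 + (j - i)) • K j r i hl.1 hl.2 else 0)
    (fun j r s => ∑ i ∈ Finset.range (k - 2 + 1), if i ≤ j then
      ∑ hl ∈ Finset.HasAntidiagonal.antidiagonal (s + 1),
        if hl.1 + (j - i) = 1 then K j r i hl.1 hl.2 else 0 else 0) ?_ ?_ ?_).trans ?_
  · intro j _ r _ s _
    refine HasDerivAt.fun_sum fun i _ => ?_
    split_ifs
    · exact HasDerivAt.fun_sum fun hl _ => hasDerivAt_pow_smul _ _
    · exact hasDerivAt_const _ _
  · intro j hj r hr s hs
    simp only [zero_pow_eq, ite_smul, one_smul, zero_smul]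
    rw [sum_ite_add_eq_zero _ hj, coV_toV k j hr hs]
    simp [K]
  · intro j hj r hr s hs n
    have h01 : (uElt p m ^ p ^ n).1 0 1 = (p : ℤ_[p]) ^ n * (p : ℤ_[p]) ^ m := by
      have := congrFun (congrFun (uElt_pow p m (p ^ n)) 0) 1
      simpa using this
    have h11 : (uElt p m ^ p ^ n).1 1 1 = 1 := by
      have := congrFun (congrFun (uElt_pow p m (p ^ n)) 1) 1
      simpa using this
    rw [rho_toV, coV_toV k j hr hs, coW1_actW1 k _ _ hj, h01, h11]
    refine Finset.sum_congr rfl fun i _ => ?_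
    split_ifs
    · rw [Finset.sum_mul]
      refine Finset.sum_congr rfl fun hl _ => ?_
      rw [Algebra.smul_def]
      simp only [K, map_mul, map_pow, map_natCast, map_one, one_pow, pow_add]
      ring
    · rfl
  · refine forall₂_congr fun j hj => forall₂_congr fun r hr => forall₂_congr fun s hs => ?_
    rw [sum_ite_add_eq_one _ hj, coV_toV k j hr hs.le, coV_toV k (j - 1) hr hs]
    rcases Nat.eq_zero_or_pos j with rfl | hj0
    · simp [K]
    · have e : j - (j - 1) = 1 := by omega
      simp only [K, e, if_neg hj0.ne']
      simp
      ring_nf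

/-- `∂_{m,2} = p ^ m (t ∂/∂t + e_2 ∂/∂e_2)`. -/
lemma isPartial_gammaElt_iff (hM : 1 ≤ M) (hm : padicValNat p (2 * p) ≤ m)
    (x y : V p M k n₁ n₂) :
    IsPartial M n₁ n₂ (gammaElt p m hm) x y ↔ ∀ j ≤ k - 2, ∀ r < M * n₂, ∀ s < n₁,
      coV p M k n₁ n₂ j r (s + 1) y =
        ((s + 1 + j : ℕ) : CycF p M) * (p : CycF p M) ^ m * coV p M k n₁ n₂ j r (s + 1) x := by
  obtain ⟨w, rfl⟩ := toV_surjective x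
  -- Here `d = exp(β p ^ m)`: `t ^ (s + 1)` contributes `d ^ (s + 1)` and `e_2 ^ j` contributes `d ^
  -- j`.
  refine isPartial_iff_of_hasDerivAt k hM _ y
    (fun j r s β => NormedSpace.exp (β * (p : ℚ_[p]) ^ m) ^ (s + 1 + j)
      • coV p M k n₁ n₂ j r (s + 1) (toV p M k n₁ n₂ w)) _ ?_ ?_ ?_
  · intro j _ r _ s _
    have h1 : HasDerivAt (fun β : ℚ_[p] => β * (p : ℚ_[p]) ^ m) ((p : ℚ_[p]) ^ m) 0 :=
      hasDerivAt_mul_const _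
    have h2 : HasDerivAt (NormedSpace.exp : ℚ_[p] → ℚ_[p]) 1 (0 * (p : ℚ_[p]) ^ m) := by
      rw [zero_mul]
      exact hasDerivAt_exp_zero p m hm
    refine (((h2.comp 0 h1).pow (s + 1 + j)).smul_const
      (coV p M k n₁ n₂ j r (s + 1) (toV p M k n₁ n₂ w))).congr_deriv ?_
    rw [Algebra.smul_def]
    simp
  · intro j hj r hr s hs
    simp
  · intro j hj r hr s hs n
    have h01 : (gammaElt p m hm ^ p ^ n).1 0 1 = 0 := by
      have := congrFun (congrFun (gammaElt_pow p m hm (p ^ n)) 0) 1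
      simpa using this
    have h11 : (gammaElt p m hm ^ p ^ n).1 1 1 = expP p m hm ^ p ^ n := by
      have := congrFun (congrFun (gammaElt_pow p m hm (p ^ n)) 1) 1
      simpa using this
    have he : algebraMap ℤ_[p] (CycF p M) (expP p m hm ^ p ^ n)
        = algebraMap ℚ_[p] (CycF p M) (NormedSpace.exp ((p : ℚ_[p]) ^ n * (p : ℚ_[p]) ^ m)) := by
      rw [← Nat.cast_pow, exp_natCast_mul_pow p m hm, map_pow, map_pow]
      rfl
    rw [rho_toV, coV_toV k j hr hs, coV_toV k j hr hs, coW1_actW1 k _ _ hj, h01, h11,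
      Algebra.smul_def, map_pow, ← he]
    set d := algebraMap ℤ_[p] (CycF p M) (expP p m hm ^ p ^ n)
    -- As `b = 0`, only the term with `h = 0` and `i = j` survives in the action formula.
    let K (i h l : ℕ) : CycF p M := d ^ l * coW1 p M k i r l w * d ^ i
    have h := sum_ite_add_eq_zero K hj (s + 1)
    refine Eq.trans ?_ (h.symm.trans ?_)
    · simp only [K]
      ring
    · refine Finset.sum_congr rfl fun i _ => ?_
      split_ifs with hij
      · rw [Finset.sum_mul]
        refine Finset.sum_congr rfl fun hl _ => ?_
        rw [map_mul, map_pow, map_pow, map_zero, zero_div]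
        rcases Nat.eq_zero_or_pos hl.1 with h0 | h0
        · rcases hij.eq_or_lt with rfl | hlt
          · simp [h0, K, d]
          · rw [if_neg (by omega), zero_pow (by omega : j - i ≠ 0)]
            simp
        · rw [if_neg (by omega), zero_pow h0.ne']
          simp
      · rfl

end Derivatives

/-! ### Eigenspaces, inverse limits and the isomorphism. -/

section Isomorphism

variable {p : ℕ} [Fact p.Prime] {M k m n₁ n₂ : ℕ}

lemma coV_zero_right (j : ℕ) {r : ℕ} (hr : r < M * n₂) (x : V p M k n₁ n₂) :
    coV p M k n₁ n₂ j r 0 x = 0 := by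
  obtain ⟨w, rfl⟩ := toV_surjective x
  rw [coV_toV k j hr (Nat.zero_le _), coW1_zero_right]

lemma coV_eltT (f : KPlusPlus p M) (j : ℕ) {r s : ℕ} (hr : r < M * n₂) (hs : s < n₁) :
    coV p M k n₁ n₂ j r (s + 1) (eltT p M k n₁ n₂ f).1
      = if j = 0 ∧ s = 0 then PowerSeries.coeff r f.1 else 0 :=
  (coV_toV k j hr hs _).trans (coW1_elt k f.1 j r s)

lemma cls_eq_iff {x y : T p M k n₁ n₂} :
    cls (m := m) x = cls y ↔ x.1 - y.1 ∈ dT M k n₁ n₂ m :=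
  Submodule.Quotient.eq _

/-- A term in `t e_1 ^ {k-2}` could only come from `t ^ 0 e_1 ^ {k-2}`, which the twist excludes. -/
lemma coV_eq_zero_of_mem_dT (hM : 1 ≤ M) (hn₁ : 1 ≤ n₁) {y : V p M k n₁ n₂}
    (hy : y ∈ dT M k n₁ n₂ m) {r : ℕ} (hr : r < M * n₂) : coV p M k n₁ n₂ 0 r 1 y = 0 := by
  obtain ⟨x, -, h⟩ := hy
  have := (isPartial_uElt_iff hM x y).1 h 0 (Nat.zero_le _) r hr 0 hn₁
  rwa [coV_zero_right 0 hr, mul_zero, if_pos rfl, add_zero] at this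

lemma coV_eq_of_cls_eq (hM : 1 ≤ M) (hn₁ : 1 ≤ n₁) {x y : T p M k n₁ n₂}
    (h : cls (m := m) x = cls y) {r : ℕ} (hr : r < M * n₂) :
    coV p M k n₁ n₂ 0 r 1 x.1 = coV p M k n₁ n₂ 0 r 1 y.1 := by
  rw [← sub_eq_zero, ← map_sub]
  exact coV_eq_zero_of_mem_dT hM hn₁ (cls_eq_iff.1 h) hr

variable (p M k n₁ n₂) in
/-- `f ↦ e_1 ^ {k-2} t f(q̃_M)`, as a linear map from `𝒦_M⁺⁺` to `T̃_{n₁,n₂}`. -/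
def eltTLin : KPlusPlus p M →ₗ[ℤ_[p]] T p M k n₁ n₂ where
  toFun := eltT p M k n₁ n₂
  map_add' f g := Subtype.ext <| V_ext k fun j _ r hr s hs => by
    rw [Submodule.coe_add, map_add, coV_eltT _ _ hr hs, coV_eltT _ _ hr hs, coV_eltT _ _ hr hs,
      Submodule.coe_add, map_add]
    split_ifs
    · rfl
    · rw [add_zero]
  map_smul' a f := Subtype.ext <| V_ext k fun j _ r hr s hs => by
    rw [RingHom.id_apply, Submodule.coe_smul, ← algebraMap_smul ℚ_[p] a (eltT p M k n₁ n₂ f).1,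
      map_smul, coV_eltT _ _ hr hs, coV_eltT _ _ hr hs]
    split_ifs
    · rfl
    · rw [smul_zero]

lemma trT_eltT {n₁' n₂' : ℕ} (h₁ : n₁ ≤ n₁') (h₂ : n₂ ≤ n₂') (f : KPlusPlus p M) :
    trT h₁ h₂ (eltT p M k n₁' n₂' f) = eltT p M k n₁ n₂ f :=
  Subtype.ext (tr_toV h₁ h₂ (elt p M k f.1))

/-- The only monomials involved have degree one in `t` and degree zero in `e_2`, so the eigenvector
equation holds before passing to the quotient. -/
lemma isPartial_eltT (hM : 1 ≤ M) (hm : padicValNat p (2 * p) ≤ m) (f : KPlusPlus p M) :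
    IsPartial M n₁ n₂ (gammaElt p m hm) (eltT p M k n₁ n₂ f).1
      ((p : ℤ_[p]) ^ m • eltT p M k n₁ n₂ f).1 := by
  refine (isPartial_gammaElt_iff hM hm _ _).2 fun j _ r hr s hs => ?_
  rw [Submodule.coe_smul, ← algebraMap_smul ℚ_[p] ((p : ℤ_[p]) ^ m) (eltT p M k n₁ n₂ f).1,
    map_smul, coV_eltT _ _ hr hs, Algebra.smul_def]
  split_ifs with h
  · obtain ⟨rfl, rfl⟩ := h
    simp
  · rw [mul_zero, mul_zero]

lemma cls_eltT_mem_Eig (hM : 1 ≤ M) (hm : padicValNat p (2 * p) ≤ m) (f : KPlusPlus p M) :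
    cls (eltT p M k n₁ n₂ f) ∈ Eig M k n₁ n₂ hm :=
  ⟨_, _, isPartial_eltT hM hm f, rfl, map_smul _ _ _⟩

variable (k n₁ n₂) in
/-- The map from `𝒦_M⁺⁺` to level `(n₁, n₂)` of the inverse system which sends `f` to the class of
`e_1 ^ {k-2} t f(q̃_M)`. -/
def toEigT (hM : 1 ≤ M) (hm : padicValNat p (2 * p) ≤ m) :
    KPlusPlus p M →ₗ[ℤ_[p]] EigT (p := p) M k n₁ n₂ hm :=
  LinearMap.codRestrict (Eig (p := p) M k n₁ n₂ hm) ((cls (m := m)).comp (eltTLin p M k n₁ n₂))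
    (cls_eltT_mem_Eig hM hm)

lemma toEigT_coe (hM : 1 ≤ M) (hm : padicValNat p (2 * p) ≤ m) (f : KPlusPlus p M) :
    (toEigT k n₁ n₂ hM hm f).1 = cls (eltT p M k n₁ n₂ f) := rfl

lemma trEig_coe {n₁' n₂' : ℕ} (h₁ : n₁ ≤ n₁') (h₂ : n₂ ≤ n₂')
    (hm : padicValNat p (2 * p) ≤ m) (z : EigT (p := p) M k n₁' n₂' hm) :
    (trEig h₁ h₂ hm z).1 = trCoinv h₁ h₂ z.1 := rfl

lemma trCoinv_cls_eltT {n₁' n₂' : ℕ} (h₁ : n₁ ≤ n₁') (h₂ : n₂ ≤ n₂') (f : KPlusPlus p M) :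
    trCoinv (m := m) h₁ h₂ (cls (eltT p M k n₁' n₂' f)) = cls (eltT p M k n₁ n₂ f) := by
  rw [trCoinv_cls, trT_eltT]

lemma trEig_toEigT {n₁' n₂' : ℕ} (h₁ : n₁ ≤ n₁') (h₂ : n₂ ≤ n₂') (hM : 1 ≤ M)
    (hm : padicValNat p (2 * p) ≤ m) (f : KPlusPlus p M) :
    trEig h₁ h₂ hm (toEigT k n₁' n₂' hM hm f) = toEigT k n₁ n₂ hM hm f := by
  apply Subtype.ext
  rw [trEig_coe, toEigT_coe, toEigT_coe, trCoinv_cls_eltT]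

variable (k n₁) in
/-- The map from `𝒦_M⁺⁺` to the inverse limit over `n₂` which sends `f` to the classes of
`e_1 ^ {k-2} t f(q̃_M)`. -/
def toLim₂ (hM : 1 ≤ M) (hm : padicValNat p (2 * p) ≤ m) :
    KPlusPlus p M →ₗ[ℤ_[p]] Lim₂ (p := p) M k n₁ hm :=
  LinearMap.codRestrict _ (LinearMap.pi fun n₂ => toEigT k n₁ n₂ hM hm)
    fun f n₂ => trEig_toEigT le_rfl n₂.le_succ hM hm f

lemma toLim₂_apply (hM : 1 ≤ M) (hm : padicValNat p (2 * p) ≤ m) (f : KPlusPlus p M) (n₂ : ℕ) :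
    ((toLim₂ k n₁ hM hm f).1 n₂).1 = cls (eltT p M k n₁ n₂ f) := rfl

lemma trLim₂_toLim₂ (hM : 1 ≤ M) (hm : padicValNat p (2 * p) ≤ m) :
    (trLim₂ M k n₁ hm).comp (toLim₂ k (n₁ + 1) hM hm) = toLim₂ k n₁ hM hm :=
  LinearMap.ext fun f => Subtype.ext <| funext fun _ => trEig_toEigT _ _ hM hm f

/-- The coefficient of index `r` is read at level `n₂ = r + 1`, where `r < M n₂`. -/
lemma toLim₂_injective (hM : 1 ≤ M) (hm : padicValNat p (2 * p) ≤ m) (hn₁ : 1 ≤ n₁) :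
    Function.Injective (toLim₂ (p := p) k n₁ hM hm) := by
  intro f g h
  refine Subtype.ext (PowerSeries.ext fun r => ?_)
  have hr : r < M * (r + 1) := Nat.le_mul_of_pos_left _ hM
  have h1 : cls (m := m) (eltT p M k n₁ (r + 1) f) = cls (eltT p M k n₁ (r + 1) g) :=
    congrArg (fun z : Lim₂ (p := p) M k n₁ hm => (z.1 (r + 1)).1) h
  have h2 := coV_eq_of_cls_eq hM hn₁ h1 hr
  rwa [coV_eltT _ _ hr hn₁, coV_eltT _ _ hr hn₁, if_pos ⟨rfl, rfl⟩, if_pos ⟨rfl, rfl⟩] at h2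

/-- The part of positive degree in `t` and `e_2` of the eigenspace is killed by
`p ^ m (n₁ + k)!`. -/
lemma smul_cls_eq (hM : 1 ≤ M) (hm : padicValNat p (2 * p) ≤ m) {x y : T p M k n₁ n₂}
    (h : IsPartial M n₁ n₂ (gammaElt p m hm) x.1 y.1)
    (hxy : cls (m := m) y = (p : ℤ_[p]) ^ m • cls x) (f : KPlusPlus p M)
    (hf : ∀ r < M * n₂, 1 ≤ n₁ → coV p M k n₁ n₂ 0 r 1 x.1 = PowerSeries.coeff r f.1) :
    ((p : ℤ_[p]) ^ m * ((n₁ + k).factorial : ℤ_[p])) • cls (m := m) x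
      = ((p : ℤ_[p]) ^ m * ((n₁ + k).factorial : ℤ_[p])) • cls (eltT p M k n₁ n₂ f) := by
  rw [← map_smul, cls_eq_iff] at hxy
  obtain ⟨w, ⟨w', hw', rfl⟩, hu⟩ := hxy
  rw [← map_smul, ← map_smul, cls_eq_iff]
  -- The part of `w'` of total degree `D = s + 1 + j` is divided by `D`, because `∂_{m,1}` sends it
  -- to degree `D + 1`, where `∂_{m,2} - p ^ m` is `p ^ m D`. The factorial keeps the result in the
  -- lattice.
  let a (j r s : ℕ) : CycF p M :=
    (((n₁ + k).factorial / (s + 1 + j) : ℕ) : ℤ_[p]) • coW1 p M k j r (s + 1) w'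
  have ha (j : ℕ) (hj : j ≤ k - 2) {r : ℕ} (hr : r < M * n₂) {s : ℕ} (hs : s ≤ n₁) :
      coV p M k n₁ n₂ j r s (toV p M k n₁ n₂ (mkW1 p M k a))
        = (((n₁ + k).factorial / (s + j) : ℕ) : CycF p M)
          * coV p M k n₁ n₂ j r s (toV p M k n₁ n₂ w') := by
    -- For `s = 0` both coefficients vanish; this covers `s = j = 0`, where the natural number
    -- quotient by zero is meaningless.
    cases s with
    | zero => rw [coV_zero_right j hr, coV_zero_right j hr, mul_zero]
    | succ s =>
      rw [coV_toV k j hr hs, coV_toV k j hr hs, coW1_mkW1, if_pos hj]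
      simp only [a]
      rw [Algebra.smul_def, map_natCast]
  refine ⟨toV p M k n₁ n₂ (mkW1 p M k a), ⟨_, mkW1_mem_N1 k fun j r s => ?_, rfl⟩, ?_⟩
  · exact (norm_smul_le' _ _).trans (norm_coW1_le k hw' _ _ _)
  refine (isPartial_uElt_iff hM _ _).2 fun j hj r hr s hs => ?_
  have h1 := (isPartial_uElt_iff hM _ _).1 hu j hj r hr s hs
  have h2 := (isPartial_gammaElt_iff hM hm _ _).1 h j hj r hr s hs
  have hsm (c : ℤ_[p]) (v : V p M k n₁ n₂) : coV p M k n₁ n₂ j r (s + 1) (c • v)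
      = algebraMap ℤ_[p] (CycF p M) c * coV p M k n₁ n₂ j r (s + 1) v := by
    rw [← algebraMap_smul ℚ_[p] c v, map_smul, Algebra.smul_def]
    rfl
  rw [Submodule.coe_smul, map_sub, hsm, map_pow, map_natCast, h2] at h1
  rw [Submodule.coe_smul, Submodule.coe_smul, map_sub, hsm, hsm, coV_eltT _ _ hr hs, map_mul,
    map_pow, map_natCast, map_natCast, ha j hj hr hs.le, ha (j - 1) (by omega) hr hs]
  simp only [LinearMap.coe_restrictScalars] at h1
  -- In degree one `x` and `f` agree by `hf` and `∂_{m,1}` contributes nothing; in higher degree `f`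
  -- has no term.
  rcases Nat.eq_zero_or_pos (s + j) with h0 | h0
  · obtain rfl : s = 0 := by omega
    obtain rfl : j = 0 := by omega
    rw [if_pos ⟨rfl, rfl⟩, hf r hr hs, sub_self, coV_zero_right 0 hr, if_pos rfl]
    ring
  · rw [if_neg (by omega : ¬ (j = 0 ∧ s = 0)), mul_zero, sub_zero]
    have hd : ((n₁ + k).factorial : CycF p M)
        = (((n₁ + k).factorial / (s + j) : ℕ) : CycF p M) * ((s + j : ℕ) : CycF p M) := by
      rw [← Nat.cast_mul, Nat.div_mul_cancel (Nat.dvd_factorial h0 (by omega))]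
    have h3 : ((s + 1 + j : ℕ) : CycF p M) = ((s + j : ℕ) : CycF p M) + 1 := by
      push_cast
      ring
    rw [h3] at h1
    rw [hd]
    -- Both sources of `∂_{m,1}` have total degree `s + j`, so the same factor comes out of the two
    -- terms.
    have h4 : (if j = 0 then 0 else (p : CycF p M) ^ m * ((k - 2 - (j - 1) : ℕ) : CycF p M)
          * ((((n₁ + k).factorial / (s + 1 + (j - 1)) : ℕ) : CycF p M)
            * coV p M k n₁ n₂ (j - 1) r (s + 1) (toV p M k n₁ n₂ w')))
        = (((n₁ + k).factorial / (s + j) : ℕ) : CycF p M) *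
          if j = 0 then 0 else (p : CycF p M) ^ m * ((k - 2 - (j - 1) : ℕ) : CycF p M)
            * coV p M k n₁ n₂ (j - 1) r (s + 1) (toV p M k n₁ n₂ w') := by
      split_ifs
      · rw [mul_zero]
      · rw [show s + 1 + (j - 1) = s + j by omega]
        ring
    rw [h4]
    linear_combination (((n₁ + k).factorial / (s + j) : ℕ) : CycF p M) * h1

/-- Needed for coefficients that are visible, and then constant, only from some level on. -/
lemma eq_of_forall_succ_eq {A : Type*} {P : ℕ → Prop} {a : ℕ → A}
    (hP : ∀ i j, i ≤ j → P i → P j) (ha : ∀ i, P i → a (i + 1) = a i) {i j : ℕ} (hi : P i)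
    (hj : P j) : a i = a j := by
  have key : ∀ i j, i ≤ j → P i → a j = a i := by
    intro i j hij hi
    induction j, hij using Nat.le_induction with
    | base => rfl
    | succ j hij ih => rw [ha j (hP i j hij hi), ih]
  rcases le_total i j with h | h
  · exact (key i j h hi).symm
  · exact key j i h hj

lemma exists_smul_eq_toLim₂ (hM : 1 ≤ M) (hm : padicValNat p (2 * p) ≤ m) (hn₁ : 1 ≤ n₁)
    (z : Lim₂ (p := p) M k n₁ hm) : ∃ f : KPlusPlus p M,
      ((p : ℤ_[p]) ^ m * ((n₁ + k).factorial : ℤ_[p])) • z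
        = toLim₂ k n₁ hM hm (((p : ℤ_[p]) ^ m * ((n₁ + k).factorial : ℤ_[p])) • f) := by
  choose x y h hz hxy using fun n₂ => (z.1 n₂).2
  have hr (r : ℕ) : r < M * (r + 1) := Nat.le_mul_of_pos_left _ hM
  have hc (n₂ r : ℕ) (hr' : r < M * n₂) :
      coV p M k n₁ n₂ 0 r 1 (x n₂).1 = coV p M k n₁ (r + 1) 0 r 1 (x (r + 1)).1 := by
    refine eq_of_forall_succ_eq (P := fun n => r < M * n)
      (a := fun n => coV p M k n₁ n 0 r 1 (x n).1)
      (fun i j hij hi => hi.trans_le (Nat.mul_le_mul_left M hij)) (fun n hn => ?_) hr' (hr r)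
    have e : cls (m := m) (trT le_rfl n.le_succ (x (n + 1))) = cls (x n) := by
      rw [← trCoinv_cls, ← hz, ← hz]
      exact congrArg Subtype.val (z.2 n)
    exact (coV_tr k le_rfl n.le_succ 0 hn hn₁ _).symm.trans (coV_eq_of_cls_eq hM hn₁ e hn)
  -- Each coefficient is taken from the first level sure to see it; the lattice bound there is
  -- exactly the one defining `𝒦_M⁺⁺`.
  let f : KPlusPlus p M := ⟨PowerSeries.mk fun r => coV p M k n₁ (r + 1) 0 r 1 (x (r + 1)).1,
    fun r => by
      rw [PowerSeries.coeff_mk]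
      exact norm_coV_le k (x (r + 1)).2 0 (hr r) hn₁⟩
  refine ⟨f, ?_⟩
  rw [map_smul]
  refine Subtype.ext (funext fun n₂ => Subtype.ext ?_)
  have e := smul_cls_eq hM hm (h n₂) (by rw [hxy, hz]) f fun r hr' _ =>
    (hc n₂ r hr').trans (by simp only [f, PowerSeries.coeff_mk])
  rw [← hz] at e
  exact e

/-- Injectivity survives because `ℚ_p` is flat over `ℤ_p`; surjectivity holds because the cokernel
is killed by a nonzero integer. -/
lemma baseChange_toLim₂_bijective (hM : 1 ≤ M) (hm : padicValNat p (2 * p) ≤ m) (hn₁ : 1 ≤ n₁) :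
    Function.Bijective ((toLim₂ (p := p) k n₁ hM hm).baseChange ℚ_[p]) := by
  refine ⟨Module.Flat.lTensor_preserves_injective_linearMap (M := ℚ_[p]) (toLim₂ k n₁ hM hm)
    (toLim₂_injective hM hm hn₁), ?_⟩
  intro w
  induction w using TensorProduct.induction_on with
  | zero => exact ⟨0, LinearMap.map_zero _⟩
  | add a b ha hb =>
    obtain ⟨a', rfl⟩ := ha
    obtain ⟨b', rfl⟩ := hb
    exact ⟨a' + b', LinearMap.map_add _ _ _⟩
  | tmul c z =>
    obtain ⟨f, hf⟩ := exists_smul_eq_toLim₂ hM hm hn₁ z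
    set N : ℤ_[p] := (p : ℤ_[p]) ^ m * ((n₁ + k).factorial : ℤ_[p])
    have hN : (N : ℚ_[p]) ≠ 0 := by
      have hp : (p : ℚ_[p]) ≠ 0 := by exact_mod_cast (Fact.out : p.Prime).ne_zero
      have hk : ((n₁ + k).factorial : ℚ_[p]) ≠ 0 := by
        exact_mod_cast (n₁ + k).factorial_ne_zero
      simp [N, hp, Nat.factorial_ne_zero]
    refine ⟨(c * (N : ℚ_[p])⁻¹) ⊗ₜ (N • f), ?_⟩
    rw [LinearMap.baseChange_tmul, ← hf, ← TensorProduct.smul_tmul, Algebra.smul_def]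
    congr 1
    change (N : ℚ_[p]) * (c * (N : ℚ_[p])⁻¹) = c
    field_simp

variable (k) in
/-- The map `f(q_M) ↦ e_1 ^ {k-2} t f(q̃_M)` on `𝒦_M⁺`. -/
def toLim (hM : 1 ≤ M) (hm : padicValNat p (2 * p) ≤ m) :
    KPlus p M →ₗ[ℚ_[p]] Lim (p := p) M k hm :=
  (LinearMap.pi fun n₁ => (toLim₂ k n₁ hM hm).baseChange ℚ_[p]).codRestrict _ fun x n₁ => by
    rw [LinearMap.pi_apply, LinearMap.pi_apply, ← LinearMap.comp_apply,
      ← LinearMap.baseChange_comp, trLim₂_toLim₂]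

lemma toLim_apply (hM : 1 ≤ M) (hm : padicValNat p (2 * p) ≤ m) (x : KPlus p M) (n₁ : ℕ) :
    (toLim k hM hm x).1 n₁ = (toLim₂ k n₁ hM hm).baseChange ℚ_[p] x := rfl

lemma toLim_bijective (hM : 1 ≤ M) (hm : padicValNat p (2 * p) ≤ m) :
    Function.Bijective (toLim (p := p) k hM hm) := by
  constructor
  · intro x y h
    exact (baseChange_toLim₂_bijective (k := k) hM hm le_rfl).1
      (congrArg (fun z : Lim (p := p) M k hm => z.1 1) h)
  · intro z
    obtain ⟨x, hx⟩ := (baseChange_toLim₂_bijective hM hm le_rfl).2 (z.1 1)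
    -- A preimage at level `n + 1` is also one at level `n`; injectivity at level `n ≥ 1` then
    -- forces all preimages to coincide, and level `0` follows from level `1`.
    have hstep (x' : KPlus p M) (n : ℕ)
        (h : (toLim₂ k (n + 1) hM hm).baseChange ℚ_[p] x' = z.1 (n + 1)) :
        (toLim₂ k n hM hm).baseChange ℚ_[p] x' = z.1 n := by
      rw [← z.2 n, ← h]
      exact ((toLim k hM hm x').2 n).symm
    refine ⟨x, Subtype.ext (funext fun n => ?_)⟩
    rw [toLim_apply]
    rcases Nat.eq_zero_or_pos n with rfl | hn
    · exact hstep x 0 hx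
    · induction n, hn using Nat.le_induction with
      | base => exact hx
      | succ n hn ih =>
        obtain ⟨x', hx'⟩ := (baseChange_toLim₂_bijective hM hm (Nat.le_add_left 1 n)).2
          (z.1 (n + 1))
        rw [← hx', (baseChange_toLim₂_bijective hM hm hn).1 (ih.trans (hstep x' n hx').symm)]

end Isomorphism

end EllPolylog

end

theorem mainTheorem3 (p : ℕ) [Fact p.Prime] (M k m : ℕ) (hM : 1 ≤ M) (hk : 2 ≤ k)
    (hMm : padicValNat p M = m) (hm : padicValNat p (2 * p) ≤ m) :
    ∃ e : EllPolylog.KPlus p M ≃ₗ[ℚ_[p]] EllPolylog.Lim (p := p) M k hm,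
      ∀ (f : EllPolylog.KPlusPlus p M) (n₁ : ℕ),
        ∃ z : EllPolylog.Lim₂ (p := p) M k n₁ hm,
          (∀ n₂ : ℕ, (z.1 n₂).1 = EllPolylog.cls (EllPolylog.eltT p M k n₁ n₂ f)) ∧
          (e ((1 : ℚ_[p]) ⊗ₜ[ℤ_[p]] f)).1 n₁ = (1 : ℚ_[p]) ⊗ₜ[ℤ_[p]] z :=
  ⟨LinearEquiv.ofBijective (EllPolylog.toLim k hM hm) (EllPolylog.toLim_bijective hM hm),
    fun f n₁ => ⟨EllPolylog.toLim₂ k n₁ hM hm f, EllPolylog.toLim₂_apply hM hm f,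
      LinearMap.baseChange_tmul _ _ _⟩⟩
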